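/- **Theorem (full-field learning: convergence rate for Sobolev QoI).** *Notation.* For $s\in\mathbb R$ let $\mathcal H^s=\{v:\mathbb N\to\mathbb R : \sum_{j\ge1} j^{2s}|v_j|^2<\infty\}$. Write $a_j\asymp b_j$ if $c^{-1}b_j\le a_j\le c\,b_j$ for some $c\ge1$ and all large $j$, and $a_j\lesssim b_j$ if $a_j\le c\,b_j$ for some $c>0$ and all large $j$. *Setting.* Let $H$ be a real separable infinite-dimensional Hilbert space with orthonormal basis $\{\varphi_j\}_{j\ge1}$. - (Training inputs) $\nu$ is a centered Borel probability measure on $H$ with two finite moments and covariance $\Sigma=\sum_j\sigma_j\varphi_j\otimes\varphi_j$, where $\{\sigma_j\}$ is nonincreasing and $\sigma_j\asymp j^{-2\alpha}$ for some $\alpha>1/2$. Under $u\sim\nu$, the normalized coefficients $z_j=\langle\varphi_j,u\rangle/\sqrt{\sigma_j}$ are independent and $\sup_j\sup_{\ell\ge1}\ell^{-1/2}(\mathbb E|z_j|^\ell)^{1/\ell}<\infty$. - (Test inputs) $\nu'$ is a centered probability measure, supported on a possibly larger space than $H$ and identified with the joint law of the coefficients $\{u'_j\}$ of $u'$ with respect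 to $\{\varphi_j\}$. Its covariance is $\sum_j\sigma'_j\varphi_j\otimes\varphi_j$, that is, $\mathbb E\,u'_j=0$ and $\mathbb E\,u'_ju'_k=\sigma'_j\delta_{jk}$, where $\sigma'_j\lesssim j^{-2\alpha'}$ for some $\alpha'\ge0$. - (Forward map) $L^\dagger=\sum_j l^\dagger_j\varphi_j\otimes\varphi_j$ is a possibly unbounded self-adjoint operator on its maximal domain, with $\{l^\dagger_j\}\in\mathcal H^\beta$ for some $\beta\in\mathbb R$. - (QoI) $q^\dagger$ is a possibly unbounded linear functional, defined on a subspace of $H$ that contains every $\varphi_j$, with $\{q^\dagger(\varphi_j)\}\in\mathcal H^r$ for some $r\in\mathbb R$ and $\sum_j|q^\dagger(\varphi_j)|^2|l_j^\dagger|^2<\infty$. For a diagonal operator $L=\sum_j l_j\varphi_j\otimes\varphi_j$, the function $u'\mapsto q^\dagger(Lu')$ is understood as the sum in $L^2(\nu')$ of the series $\sum_j q^\dagger(\varphi_j)\,l_j\,u'_j$. - (Data) The inputs $U=\{u_n\}_{n=1}^N\sim\nu^{\otimes N}$ and outputs $\Upsilon=\{Y_n\}_{n=1}^N$ satisfy $Y_n=L^\dagger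 u_n+\eta_n$, where $\eta_n\sim N(0,\mathrm{Id}_H)$ are iid Gaussian white noises independent of $U$. The equation is understood as one between $H$-indexed processes. - (Prior, posterior, estimator) The eigenvalues have independent priors $l_j\sim N(0,\mu_j)$ with $\mu_j>0$ for all $j$ and $\mu_j\asymp j^{-2\beta-1}$. The resulting posterior is $l\,|\,(U,\Upsilon)\sim\bigotimes_j N(\bar l^{(N)}_j,c^{(N)}_j)$, where the factor of index $j$ is obtained from $N(0,\mu_j)$ by Bayes' rule with likelihood proportional to $t\mapsto\exp\bigl(-\tfrac12\sum_{n=1}^N (Y_n(\varphi_j)-t\langle\varphi_j,u_n\rangle)^2\bigr)$. Put $\bar L^{(N)}=\sum_j\bar l_j^{(N)}\varphi_j\otimes\varphi_j$. The plug-in estimator of $q^\dagger\circ L^\dagger$ is $q^\dagger\circ\bar L^{(N)}$. *Claim.* Suppose $\min(\alpha,\alpha'+r)+\beta>0$. Then $u\in\operatorname{dom}(L^\dagger)$ for $\nu$-a.e. $u$, the series defining $q^\dagger(L^\dagger u')$ converges in $L^2(\nu')$, and for every $N$, almost surely, so does the one defining $q^\dagger(\bar L^{(N)}u')$. Moreover,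 there exist constants $c,C,K>0$, independent of $N$, such that for all sufficiently large $N$ the bound $$\mathbb E^{\Upsilon\,|\,U}\,\mathbb E^{u'\sim\nu'}\bigl|q^\dagger(L^\dagger u')-q^\dagger(\bar L^{(N)}u')\bigr|^2\le K\varepsilon_N^2$$ holds with probability at least $1-Ce^{-cN}$ over $U\sim\nu^{\otimes N}$, where $$\varepsilon_N^2=\begin{cases}N^{-\frac{2\alpha'+2\beta+2r}{1+2\alpha+2\beta}},&\alpha'+r<\alpha+1/2,\\ N^{-1}\log N,&\alpha'+r=\alpha+1/2,\\ N^{-1},&\alpha'+r>\alpha+1/2.\end{cases}$$ -/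

import Mathlib

open MeasureTheory ProbabilityTheory Filter Topology
open scoped NNReal ENNReal RealInnerProductSpace

noncomputable section

namespace FullField

/-! Basis vectors and coefficient sequences are indexed by `ℕ` starting from `0`; index `j` here is
index `j + 1` in the customary numbering, so weights are powers of `(j : ℝ) + 1`. -/

/-- `a_j ≍ b_j` as `j → ∞`. -/
def AsympEquiv (a b : ℕ → ℝ) : Prop :=
  ∃ c : ℝ, 1 ≤ c ∧ ∀ᶠ j in atTop, c⁻¹ * b j ≤ a j ∧ a j ≤ c * b j

/-- `a_j ≲ b_j` as `j → ∞`, for nonnegative sequences. -/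
def AsympLE (a b : ℕ → ℝ) : Prop :=
  ∃ c : ℝ, 0 < c ∧ ∀ᶠ j in atTop, a j ≤ c * b j

/-- The power weights `j ↦ j ^ p`. -/
def powSeq (p : ℝ) (j : ℕ) : ℝ := ((j : ℝ) + 1) ^ p

/-- Membership in the Sobolev-like sequence space `ℋ^s`: `∑ j ^ (2 s) |v_j| ^ 2 < ∞`. -/
def MemSobolevSeq (s : ℝ) (v : ℕ → ℝ) : Prop :=
  Summable fun j => powSeq (2 * s) j * |v j| ^ 2

/-- The subgaussian norm `sup_{ℓ ≥ 1} ℓ ^ (-1/2) (𝔼 |X| ^ ℓ) ^ (1/ℓ)`, with values in `[0, ∞]`. -/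
def subgaussianNorm {Ω : Type*} [MeasurableSpace Ω] (X : Ω → ℝ) (P : Measure Ω) : ℝ≥0∞ :=
  ⨆ (ℓ : ℝ) (_ : 1 ≤ ℓ), eLpNorm X (ENNReal.ofReal ℓ) P / ENNReal.ofReal (Real.sqrt ℓ)

/-- A partially defined linear map as a total function, with value `0` off its domain. -/
def evalExt {E F : Type*} [AddCommGroup E] [Module ℝ E] [AddCommGroup F] [Module ℝ F]
    (T : E →ₗ.[ℝ] F) (x : E) : F :=
  open Classical in if hx : x ∈ T.domain then T ⟨x, hx⟩ else 0

section Hilbert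

variable {H : Type*} [NormedAddCommGroup H] [InnerProductSpace ℝ H]

/-- The maximal domain `{u | ∑ l_j ^ 2 ⟪φ_j, u⟫ ^ 2 < ∞}` of `∑ l_j φ_j ⊗ φ_j`. -/
def diagDomain (φ : HilbertBasis ℕ ℝ H) (l : ℕ → ℝ) : Submodule ℝ H where
  carrier := {u | Memℓp (fun j => l j * ⟪φ j, u⟫) 2}
  add_mem' := by
    intro a b ha hb
    have h := Memℓp.add ha hb
    have e : (fun j => l j * ⟪φ j, a + b⟫)
        = (fun j => l j * ⟪φ j, a⟫) + fun j => l j * ⟪φ j, b⟫ := by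
      funext j; simp [inner_add_right, mul_add]
    change Memℓp (fun j => l j * ⟪φ j, a + b⟫) 2
    rw [e]
    exact h
  zero_mem' := by
    have e : (fun j => l j * ⟪φ j, (0 : H)⟫) = (0 : ℕ → ℝ) := by
      funext j; simp
    change Memℓp (fun j => l j * ⟪φ j, (0 : H)⟫) 2
    rw [e]
    exact zero_memℓp
  smul_mem' := by
    intro c a ha
    have h := Memℓp.const_smul ha c
    have e : (fun j => l j * ⟪φ j, c • a⟫) = c • fun j => l j * ⟪φ j, a⟫ := by
      funext j; simp [inner_smul_right, mul_left_comm]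
    change Memℓp (fun j => l j * ⟪φ j, c • a⟫) 2
    rw [e]
    exact h

/-- The coefficients `(l_j ⟪φ_j, u⟫)_j` of the image of `u`. -/
def diagCoeff (φ : HilbertBasis ℕ ℝ H) (l : ℕ → ℝ) : diagDomain φ l →ₗ[ℝ] lp (fun _ : ℕ => ℝ) 2 where
  toFun u := ⟨fun j => l j * ⟪φ j, (u : H)⟫, u.2⟩
  map_add' a b := by
    apply Subtype.ext
    funext j
    change l j * ⟪φ j, (a : H) + (b : H)⟫ = l j * ⟪φ j, (a : H)⟫ + l j * ⟪φ j, (b : H)⟫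
    rw [inner_add_right, mul_add]
  map_smul' c a := by
    apply Subtype.ext
    funext j
    change l j * ⟪φ j, c • (a : H)⟫ = c * (l j * ⟪φ j, (a : H)⟫)
    rw [inner_smul_right, mul_left_comm]

/-- The (possibly unbounded) self-adjoint operator `∑ l_j φ_j ⊗ φ_j` on its maximal domain. -/
def diagOp (φ : HilbertBasis ℕ ℝ H) (l : ℕ → ℝ) : H →ₗ.[ℝ] H where
  domain := diagDomain φ l
  toFun := φ.repr.symm.toLinearEquiv.toLinearMap ∘ₗ diagCoeff φ l

variable [MeasurableSpace H] [BorelSpace H] [CompleteSpace H]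

/-- The training law: a centered Borel probability measure on `H` with two moments, whose covariance
operator has eigenbasis `φ` and nonincreasing eigenvalues `σ`, and whose normalized Karhunen–Loève
coefficients `⟪φ_j, u⟫ / √σ_j` are independent and uniformly subgaussian. (The law is centered, so
the uncentered covariance operator below is its covariance operator.) -/
structure IsTrainingLaw (φ : HilbertBasis ℕ ℝ H) (σ : ℕ → ℝ) (ν : Measure H) : Prop where
  prob : IsProbabilityMeasure ν
  memLp : MemLp id 2 ν
  centered : ∫ u, u ∂ν = 0
  cov : ∀ j, covarianceOperator ν (φ j) = σ j • φ j
  antitone : Antitone σ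
  indep : iIndepFun (fun j (u : H) => ⟪φ j, u⟫ / Real.sqrt (σ j)) ν
  subgaussian :
    (⨆ j, subgaussianNorm (fun u : H => ⟪φ j, u⟫ / Real.sqrt (σ j)) ν) < ∞

end Hilbert

/-- The test law. It may live on a space larger than `H`, so it is given as the joint law of the
coefficients `u'_j` of `u'` in the basis `φ`, a probability measure on `ℕ → ℝ` (a law on `H` is
pushed forward along `u ↦ (⟪φ_j, u⟫)_j`). It is centered, and its covariance operator is
`∑ σ'_j φ_j ⊗ φ_j`, which need not be trace class. -/
structure IsTestLaw (σ' : ℕ → ℝ) (ν' : Measure (ℕ → ℝ)) : Prop where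
  prob : IsProbabilityMeasure ν'
  memLp : ∀ j, MemLp (fun x : ℕ → ℝ => x j) 2 ν'
  centered : ∀ j, ∫ x, x j ∂ν' = 0
  cov : ∀ j k, ∫ x, x j * x k ∂ν' = if j = k then σ' j else 0

section Hilbert

variable {H : Type*} [NormedAddCommGroup H] [InnerProductSpace ℝ H]

/-- Gaussian white noise `N(0, Id_H)`, in the weak sense of an `H`-indexed process: a centered
Gaussian process with covariance `𝔼 ξ(g) ξ(h) = ⟪g, h⟫`. -/
structure IsWhiteNoise {Ω : Type*} [MeasurableSpace Ω] (ξ : H → Ω → ℝ) (P : Measure Ω) : Prop where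
  gaussian : IsGaussianProcess ξ P
  centered : ∀ h, ∫ ω, ξ h ω ∂P = 0
  cov : ∀ g h, ∫ ω, ξ g ω * ξ h ω ∂P = ⟪g, h⟫

/-- The full-field observations `Y_n = L u_n + η_n` as `H`-indexed processes,
`Y_n(h) = ⟪L u_n, h⟫ + η_n(h)`. -/
def fullFieldData {N : ℕ} (L : H →ₗ.[ℝ] H) (U : Fin N → H) (η : Fin N → H → ℝ)
    (n : Fin N) (h : H) : ℝ :=
  ⟪evalExt L (U n), h⟫ + η n h

/-- The posterior of the eigenvalue sequence given inputs `U` and outputs `Y`, under the prior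
`⨂ N(0, μ_j)` and the likelihood of the model `Y_n = ∑ t_j ⟪φ_j, u_n⟫ φ_j + N(0, Id_H)`.
The model decouples over `j`, and Bayes' rule for the coordinate `j` reweights `N(0, μ_j)`
by the (normalized) likelihood `exp (-(1/2) ∑_n (Y_n(φ_j) - t ⟪φ_j, u_n⟫) ^ 2)`. -/
def eigenvaluePosterior {N : ℕ} (φ : HilbertBasis ℕ ℝ H) (μ : ℕ → ℝ≥0)
    (U : Fin N → H) (Y : Fin N → H → ℝ) : Measure (ℕ → ℝ) :=
  Measure.infinitePi fun j =>
    (gaussianReal 0 (μ j)).tilted fun t => -(∑ n, (Y n (φ j) - t * ⟪φ j, U n⟫) ^ 2) / 2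

/-- The posterior mean eigenvalues. -/
def posteriorMeanEigenvalue {N : ℕ} (φ : HilbertBasis ℕ ℝ H) (μ : ℕ → ℝ≥0)
    (U : Fin N → H) (Y : Fin N → H → ℝ) (j : ℕ) : ℝ :=
  ∫ l, l j ∂(eigenvaluePosterior φ μ U Y)

/-- The posterior mean operator `∑ l̄_j φ_j ⊗ φ_j`. -/
def posteriorMeanOp {N : ℕ} (φ : HilbertBasis ℕ ℝ H) (μ : ℕ → ℝ≥0)
    (U : Fin N → H) (Y : Fin N → H → ℝ) : H →ₗ.[ℝ] H :=
  diagOp φ (posteriorMeanEigenvalue φ μ U Y)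

/-- The term `q(L(u'_j φ_j)) = u'_j q(L φ_j)` of `q(L u')`, as an element of `L²(ν')`. -/
def ptoTerm (q : H →ₗ.[ℝ] ℝ) (L : H →ₗ.[ℝ] H) (φ : HilbertBasis ℕ ℝ H)
    {ν' : Measure (ℕ → ℝ)} (hν' : ∀ j, MemLp (fun x : ℕ → ℝ => x j) 2 ν') (j : ℕ) : Lp ℝ 2 ν' :=
  evalExt q (evalExt L (φ j)) • (hν' j).toLp _

/-- The map `u' ↦ q(L u')` as an element of `L²(ν')`: the sum in `L²(ν')` of the series
`∑ u'_j q(L φ_j)`. It is meaningful when that series is summable. -/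
def pto (q : H →ₗ.[ℝ] ℝ) (L : H →ₗ.[ℝ] H) (φ : HilbertBasis ℕ ℝ H)
    {ν' : Measure (ℕ → ℝ)} (hν' : ∀ j, MemLp (fun x : ℕ → ℝ => x j) 2 ν') : Lp ℝ 2 ν' :=
  ∑' j, ptoTerm q L φ hν' j

/-- The conditional expected test error `𝔼^{Υ|U} 𝔼^{u' ∼ ν'} |q(L† u') - q(L̄ u')| ^ 2` at inputs
`U`: the inputs are fixed and the outputs `Υ` vary through the noise. -/
def condTestError {N : ℕ} {Ω : Type*} [MeasurableSpace Ω] (P : Measure Ω)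
    (η : Fin N → H → Ω → ℝ) (q : H →ₗ.[ℝ] ℝ) (L : H →ₗ.[ℝ] H) (φ : HilbertBasis ℕ ℝ H)
    (μ : ℕ → ℝ≥0) {ν' : Measure (ℕ → ℝ)} (hν' : ∀ j, MemLp (fun x : ℕ → ℝ => x j) 2 ν')
    (U : Fin N → H) : ℝ≥0∞ :=
  ∫⁻ ω, ∫⁻ x, ‖pto q L φ hν' x
      - pto q (posteriorMeanOp φ μ U (fullFieldData L U fun n h => η n h ω)) φ hν' x‖ₑ ^ 2 ∂ν' ∂P

end Hilbert

/-- The rate `ε_N ^ 2`. -/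
def rate (α α' β r : ℝ) (N : ℕ) : ℝ :=
  open Classical in
  if α' + r < α + 1 / 2 then (N : ℝ) ^ (-((2 * α' + 2 * β + 2 * r) / (1 + 2 * α + 2 * β)))
  else if α' + r = α + 1 / 2 then (N : ℝ)⁻¹ * Real.log N
  else (N : ℝ)⁻¹

end FullField

end

namespace FullField

/-! ### Gaussian conjugacy and the posterior mean -/

/-! The model decouples over the eigenbasis into scalar ridge regressions. With `s = ∑ₙ ⟪φ j, uₙ⟫²`,
averaging over the noise gives the posterior mean the risk `(l² + μ² s) / (1 + μ s)²`, squared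
shrinkage bias plus variance. As the test coefficients are uncorrelated, the test error is at most
the sum of these risks with weights `b² σ'`, where `b = q(φ j)` (`condTestError_le`).

Write `s = σ R`, with `R` the sum over the sample of squared normalized coefficients, `Q = j^(2r)
b²`, `κ = 1 + 2α + 2β`, `x = j^κ` and `θ = (2α' + 2β + 2r) / κ`. Then `μ σ ≍ 1/x`, and `b² σ'
j^(-2β) ≲ Q x^(-θ)`. If `x ≤ N`, then `j ≤ N`, and `R ≥ N/2` makes the contribution `≲ Q x^(-θ)
(x/N)`. If `x > N`, dropping the denominator leaves `≲ Q x^(-θ) (1 + R/N)`. Both are `≲ max(N⁻¹,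
N^(-θ)) Q (1 + R/N)` (`weighted_risk_le`), and this maximum is at most the claimed rate in all three
regimes. Since `Q` is summable, only `∑ Q R ≲ N` is still needed.

Thus two random events suffice (`exists_concentration`): `R ≥ N/2` for the first `N` indices, by a
one-sided Chernoff bound using fourth moments and a union bound; and `∑ Q R ≤ B N` over all indices
at once, by Chernoff applied to a convex combination of the squared coefficients. -/

/-- A Gaussian density times a Gaussian regression likelihood is a multiple of the conjugate
Gaussian density. -/
theorem gaussianPDFReal_mul_exp_likelihood {N : ℕ} {v w : ℝ≥0} (hv : 0 < v) (x y : Fin N → ℝ)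
    (hw : (w : ℝ) = v / (1 + v * ∑ n, x n ^ 2)) :
    ∃ k : ℝ, 0 < k ∧ ∀ t, gaussianPDFReal 0 v t * Real.exp (-(∑ n, (y n - t * x n) ^ 2) / 2)
      = k * gaussianPDFReal (v * (∑ n, x n * y n) / (1 + v * ∑ n, x n ^ 2)) w t := by
  have hv' : (0 : ℝ) < v := hv
  have hA : 0 ≤ ∑ n, x n ^ 2 := Finset.sum_nonneg fun _ _ => sq_nonneg _
  have hexp : ∀ t, ∑ n, (y n - t * x n) ^ 2
      = ∑ n, y n ^ 2 - 2 * t * ∑ n, x n * y n + t ^ 2 * ∑ n, x n ^ 2 := by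
    intro t
    simp only [Finset.mul_sum, ← Finset.sum_sub_distrib, ← Finset.sum_add_distrib]
    exact Finset.sum_congr rfl fun _ _ => by ring
  generalize (∑ n, x n ^ 2) = A at *
  generalize (∑ n, x n * y n) = B at *
  generalize (∑ n, y n ^ 2) = D at *
  have h1 : 0 < 1 + v * A := by positivity
  have hwpos : (0 : ℝ) < w := by rw [hw]; positivity
  -- Completing the square in `t` leaves the ratio of the normalizing constants times the
  -- exponential of the terms free of `t`.
  refine ⟨(√(2 * Real.pi * v))⁻¹ * √(2 * Real.pi * w)
    * Real.exp ((v * B / (1 + v * A)) ^ 2 / (2 * w) - D / 2), by positivity, fun t => ?_⟩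
  have hs : √(2 * Real.pi * w) ≠ 0 := by positivity
  have he : Real.exp (-(t - 0) ^ 2 / (2 * v)) * Real.exp (-(∑ n, (y n - t * x n) ^ 2) / 2)
      = Real.exp ((v * B / (1 + v * A)) ^ 2 / (2 * w) - D / 2)
        * Real.exp (-(t - v * B / (1 + v * A)) ^ 2 / (2 * w)) := by
    rw [← Real.exp_add, ← Real.exp_add, hexp, hw]
    congr 1
    field_simp
    ring
  rw [gaussianPDFReal, gaussianPDFReal, mul_assoc, he]
  field_simp

/-- Tilting a centered Gaussian by a function whose exponential turns its density into a multiple of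
another Gaussian density gives that other Gaussian's mean. -/
theorem tilted_gaussianReal_of_pdf {v w : ℝ≥0} (hv : v ≠ 0) (hw : w ≠ 0) {f : ℝ → ℝ} {k m : ℝ}
    (hk : 0 < k)
    (hpdf : ∀ t, gaussianPDFReal 0 v t * Real.exp (f t) = k * gaussianPDFReal m w t) :
    IsProbabilityMeasure ((gaussianReal 0 v).tilted f) ∧
      ∫ t, t ∂((gaussianReal 0 v).tilted f) = m := by
  have key : ∀ g : ℝ → ℝ, ∫ t, Real.exp (f t) * g t ∂(gaussianReal 0 v)
      = k * ∫ t, g t ∂(gaussianReal m w) := by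
    intro g
    rw [integral_gaussianReal_eq_integral_smul hv, integral_gaussianReal_eq_integral_smul hw,
      ← integral_const_mul]
    refine integral_congr_ae (Eventually.of_forall fun t => ?_)
    simp only [smul_eq_mul, ← mul_assoc, hpdf]
  have hnorm : ∫ t, Real.exp (f t) ∂(gaussianReal 0 v) = k := by
    simpa using key fun _ => 1
  refine ⟨isProbabilityMeasure_tilted ?_, ?_⟩
  -- The Bochner integral of a non-integrable function is `0`, whereas this one equals `k > 0`.
  · by_contra h
    rw [integral_undef h] at hnorm
    exact hk.ne hnorm
  · have h := key fun t => t
    simp only [integral_id_gaussianReal] at h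
    rw [integral_tilted, hnorm]
    simp only [smul_eq_mul, div_mul_eq_mul_div]
    rw [integral_div, h, mul_div_cancel_left₀ _ hk.ne']

/-- Tilting a centered Gaussian by a Gaussian regression likelihood gives a probability measure with
the ridge regression mean. -/
theorem tilted_gaussianReal_likelihood {N : ℕ} {v : ℝ≥0} (hv : 0 < v) (x y : Fin N → ℝ) :
    IsProbabilityMeasure
      ((gaussianReal 0 v).tilted fun t => -(∑ n, (y n - t * x n) ^ 2) / 2) ∧
    ∫ t, t ∂((gaussianReal 0 v).tilted fun t => -(∑ n, (y n - t * x n) ^ 2) / 2)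
      = v * (∑ n, x n * y n) / (1 + v * ∑ n, x n ^ 2) := by
  have hv' : (0 : ℝ) < v := hv
  have hA : 0 ≤ ∑ n, x n ^ 2 := Finset.sum_nonneg fun _ _ => sq_nonneg _
  have hpos : 0 < (v : ℝ) / (1 + v * ∑ n, x n ^ 2) := by positivity
  obtain ⟨k, hk, hpdf⟩ := gaussianPDFReal_mul_exp_likelihood hv x y
    (Real.coe_toNNReal _ hpos.le)
  exact tilted_gaussianReal_of_pdf hv.ne' (Real.toNNReal_pos.2 hpos).ne' hk hpdf

section Hilbert

variable {H : Type*} [NormedAddCommGroup H] [InnerProductSpace ℝ H]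

/-- The marginals of a product measure are its factors, so each posterior mean is a scalar ridge
estimate. -/
theorem posteriorMeanEigenvalue_eq {N : ℕ} (φ : HilbertBasis ℕ ℝ H) {μ : ℕ → ℝ≥0}
    (hμ : ∀ j, 0 < μ j) (U : Fin N → H) (Y : Fin N → H → ℝ) (j : ℕ) :
    posteriorMeanEigenvalue φ μ U Y j
      = μ j * (∑ n, ⟪φ j, U n⟫ * Y n (φ j)) / (1 + μ j * ∑ n, ⟪φ j, U n⟫ ^ 2) := by
  have hp := fun j => tilted_gaussianReal_likelihood (hμ j) (fun n => ⟪φ j, U n⟫)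
    (fun n => Y n (φ j))
  have := fun j => (hp j).1
  rw [← (hp j).2, ← (measurePreserving_eval_infinitePi (fun j => (gaussianReal 0 (μ j)).tilted
    fun t => -(∑ n, (Y n (φ j) - t * ⟪φ j, U n⟫) ^ 2) / 2) j).map_eq]
  exact (integral_map (β := ℝ) (φ := fun l : ℕ → ℝ => l j) (f := fun t : ℝ => t)
    (measurable_pi_apply j).aemeasurable measurable_id.aestronglyMeasurable).symm

/-! ### Diagonal operators -/

theorem mem_diagDomain_basis (φ : HilbertBasis ℕ ℝ H) (l : ℕ → ℝ) (j : ℕ) :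
    φ j ∈ (diagOp φ l).domain := by
  change Memℓp (fun k => l k * ⟪φ k, φ j⟫) 2
  have e : (fun k => l k * ⟪φ k, φ j⟫) = fun k => if k = j then l j else 0 := by
    funext k
    rw [orthonormal_iff_ite.1 φ.orthonormal k j]
    split_ifs with h <;> simp [h]
  rw [e]
  refine memℓp_gen (summable_of_ne_finset_zero (s := {j}) fun k hk => ?_)
  simp only [Finset.mem_singleton] at hk
  simp [hk]

theorem inner_diagOp (φ : HilbertBasis ℕ ℝ H) (l : ℕ → ℝ) {u : H}
    (hu : u ∈ (diagOp φ l).domain) (j : ℕ) :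
    ⟪φ j, evalExt (diagOp φ l) u⟫ = l j * ⟪φ j, u⟫ := by
  rw [evalExt, dif_pos hu, ← φ.repr_apply_apply]
  change φ.repr (φ.repr.symm (diagCoeff φ l ⟨u, hu⟩)) j = _
  rw [LinearIsometryEquiv.apply_symm_apply]
  rfl

theorem evalExt_diagOp_basis (φ : HilbertBasis ℕ ℝ H) (l : ℕ → ℝ) (j : ℕ) :
    evalExt (diagOp φ l) (φ j) = l j • φ j := by
  apply φ.repr.injective
  ext k
  simp only [φ.repr_apply_apply, inner_diagOp φ l (mem_diagDomain_basis φ l j) k, inner_smul_right]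
  rw [orthonormal_iff_ite.1 φ.orthonormal k j]
  split_ifs with h <;> simp [h]

theorem evalExt_smul {E F : Type*} [AddCommGroup E] [Module ℝ E] [AddCommGroup F] [Module ℝ F]
    (T : E →ₗ.[ℝ] F) {x : E} (hx : x ∈ T.domain) (a : ℝ) :
    evalExt T (a • x) = a • evalExt T x := by
  rw [evalExt, evalExt, dif_pos hx, dif_pos (T.domain.smul_mem a hx), ← T.map_smul]
  rfl

theorem ptoTerm_diagOp (q : H →ₗ.[ℝ] ℝ) (φ : HilbertBasis ℕ ℝ H) (hq : ∀ j, φ j ∈ q.domain)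
    (l : ℕ → ℝ) {ν' : Measure (ℕ → ℝ)} (hν' : ∀ j, MemLp (fun x : ℕ → ℝ => x j) 2 ν') (j : ℕ) :
    ptoTerm q (diagOp φ l) φ hν' j = (evalExt q (φ j) * l j) • (hν' j).toLp _ := by
  rw [ptoTerm, evalExt_diagOp_basis, evalExt_smul q (hq j), smul_eq_mul, mul_comm]

/-- Inserting the model separates the shrinkage bias from the noise. The inputs must lie in the
domain, since `evalExt` is `0` elsewhere. -/
theorem posteriorMeanEigenvalue_fullFieldData {N : ℕ} (φ : HilbertBasis ℕ ℝ H) {μ : ℕ → ℝ≥0}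
    (hμ : ∀ j, 0 < μ j) (l : ℕ → ℝ) {U : Fin N → H} (hU : ∀ n, U n ∈ (diagOp φ l).domain)
    (ξ : Fin N → H → ℝ) (j : ℕ) :
    l j - posteriorMeanEigenvalue φ μ U (fullFieldData (diagOp φ l) U ξ) j
      = (l j - μ j * ∑ n, ⟪φ j, U n⟫ * ξ n (φ j)) / (1 + μ j * ∑ n, ⟪φ j, U n⟫ ^ 2) := by
  have hA : 0 ≤ ∑ n, ⟪φ j, U n⟫ ^ 2 := Finset.sum_nonneg fun _ _ => sq_nonneg _
  have h1 : 1 + (μ j : ℝ) * ∑ n, ⟪φ j, U n⟫ ^ 2 ≠ 0 := by positivity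
  rw [posteriorMeanEigenvalue_eq φ hμ, eq_div_iff h1, sub_mul, div_mul_cancel₀ _ h1]
  have : ∑ n, ⟪φ j, U n⟫ * fullFieldData (diagOp φ l) U ξ n (φ j)
      = l j * ∑ n, ⟪φ j, U n⟫ ^ 2 + ∑ n, ⟪φ j, U n⟫ * ξ n (φ j) := by
    rw [Finset.mul_sum, ← Finset.sum_add_distrib]
    refine Finset.sum_congr rfl fun n _ => ?_
    rw [fullFieldData, real_inner_comm (φ j) (evalExt _ _), inner_diagOp φ l (hU n)]
    ring
  rw [this]
  ring

/-! ### Orthogonal series in `L²` -/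

/-- Working with lines rather than unit vectors allows some `e j` to vanish, as happens when `σ' j =
0`. -/
theorem orthogonalFamily_span_singleton {E : Type*} [NormedAddCommGroup E] [InnerProductSpace ℝ E]
    {e : ℕ → E} (he : ∀ j k, j ≠ k → ⟪e j, e k⟫ = 0) :
    OrthogonalFamily ℝ (fun j => (ℝ ∙ e j)) fun j => (ℝ ∙ e j).subtypeₗᵢ := by
  intro j k hjk x y
  obtain ⟨a, ha⟩ := Submodule.mem_span_singleton.1 x.2
  obtain ⟨b, hb⟩ := Submodule.mem_span_singleton.1 y.2
  change ⟪(x : E), (y : E)⟫ = 0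
  rw [← ha, ← hb, inner_smul_left, inner_smul_right, he j k hjk, mul_zero, mul_zero]

theorem summable_smul_orthogonal {E : Type*} [NormedAddCommGroup E] [InnerProductSpace ℝ E]
    [CompleteSpace E] {e : ℕ → E} (he : ∀ j k, j ≠ k → ⟪e j, e k⟫ = 0) (a : ℕ → ℝ) :
    (Summable fun j => a j • e j) ↔ Summable fun j => a j ^ 2 * ‖e j‖ ^ 2 := by
  have h := (orthogonalFamily_span_singleton he).summable_iff_norm_sq_summable
    fun j => a j • (⟨e j, Submodule.mem_span_singleton_self _⟩ : (ℝ ∙ e j))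
  simpa [norm_smul, mul_pow] using h

theorem norm_tsum_smul_orthogonal_sq_le {E : Type*} [NormedAddCommGroup E] [InnerProductSpace ℝ E]
    [CompleteSpace E] {e : ℕ → E} (he : ∀ j k, j ≠ k → ⟪e j, e k⟫ = 0) {a : ℕ → ℝ}
    (ha : Summable fun j => a j ^ 2 * ‖e j‖ ^ 2) :
    ‖∑' j, a j • e j‖ ^ 2 ≤ ∑' j, a j ^ 2 * ‖e j‖ ^ 2 := by
  have hs := (summable_smul_orthogonal he a).2 ha
  refine le_of_tendsto (hs.hasSum.norm.pow 2) (Eventually.of_forall fun s => ?_)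
  have h := (orthogonalFamily_span_singleton he).norm_sum
    (fun j => a j • (⟨e j, Submodule.mem_span_singleton_self _⟩ : (ℝ ∙ e j))) s
  simp only [Submodule.coe_norm, norm_smul, mul_pow, Real.norm_eq_abs, sq_abs] at h
  refine h.trans_le ?_
  exact ha.sum_le_tsum s fun j _ => by positivity

theorem IsTestLaw.inner_toLp {σ' : ℕ → ℝ} {ν' : Measure (ℕ → ℝ)} (h : IsTestLaw σ' ν') (j k : ℕ) :
    ⟪(h.memLp j).toLp _, (h.memLp k).toLp _⟫ = if j = k then σ' j else 0 := by
  rw [← h.cov j k, L2.inner_def]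
  refine integral_congr_ae ?_
  filter_upwards [(h.memLp j).coeFn_toLp, (h.memLp k).coeFn_toLp] with x hj hk
  rw [hj, hk]
  simp [mul_comm]

theorem IsTestLaw.norm_toLp_sq {σ' : ℕ → ℝ} {ν' : Measure (ℕ → ℝ)} (h : IsTestLaw σ' ν') (j : ℕ) :
    ‖(h.memLp j).toLp _‖ ^ 2 = σ' j := by
  rw [← real_inner_self_eq_norm_sq, h.inner_toLp, if_pos rfl]

theorem IsTestLaw.variance_nonneg {σ' : ℕ → ℝ} {ν' : Measure (ℕ → ℝ)} (h : IsTestLaw σ' ν')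
    (j : ℕ) : 0 ≤ σ' j := by
  rw [← h.norm_toLp_sq]
  positivity

theorem IsTestLaw.summable_ptoTerm_iff {σ' : ℕ → ℝ} {ν' : Measure (ℕ → ℝ)} (h : IsTestLaw σ' ν')
    (q : H →ₗ.[ℝ] ℝ) (φ : HilbertBasis ℕ ℝ H) (hq : ∀ j, φ j ∈ q.domain) (l : ℕ → ℝ) :
    Summable (ptoTerm q (diagOp φ l) φ h.memLp)
      ↔ Summable fun j => evalExt q (φ j) ^ 2 * σ' j * l j ^ 2 := by
  have h1 := summable_smul_orthogonal (e := fun j => (h.memLp j).toLp _)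
    (fun j k hjk => by rw [h.inner_toLp, if_neg hjk]) fun j => evalExt q (φ j) * l j
  simp only [h.norm_toLp_sq] at h1
  have e1 : ptoTerm q (diagOp φ l) φ h.memLp
      = fun j => (evalExt q (φ j) * l j) • (h.memLp j).toLp _ :=
    funext fun j => ptoTerm_diagOp q φ hq l h.memLp j
  rw [e1, h1]
  refine summable_congr fun j => ?_
  ring

theorem lintegral_enorm_sq_eq {X : Type*} [MeasurableSpace X] {ν : Measure X} (f : Lp ℝ 2 ν) :
    ∫⁻ x, ‖f x‖ₑ ^ 2 ∂ν = ENNReal.ofReal (‖f‖ ^ 2) := by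
  have h := eLpNorm_nnreal_pow_eq_lintegral (f := f) (μ := ν) (p := 2) two_ne_zero
  simp only [NNReal.coe_ofNat, ENNReal.rpow_ofNat, ENNReal.coe_ofNat] at h
  rw [← h, ← Lp.enorm_def, ← ofReal_norm, ENNReal.ofReal_pow (norm_nonneg _)]

theorem IsTestLaw.summable_error_of_ne_top {σ' : ℕ → ℝ} {ν' : Measure (ℕ → ℝ)}
    (h : IsTestLaw σ' ν') {b d : ℕ → ℝ}
    (hbd : ∑' j, ENNReal.ofReal (b j ^ 2 * σ' j * d j ^ 2) ≠ ∞) :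
    Summable fun j => b j ^ 2 * σ' j * d j ^ 2 :=
  (ENNReal.summable_toReal hbd).congr fun j => ENNReal.toReal_ofReal
    (mul_nonneg (mul_nonneg (sq_nonneg _) (h.variance_nonneg j)) (sq_nonneg _))

theorem IsTestLaw.summable_ptoTerm_of_sub {σ' : ℕ → ℝ} {ν' : Measure (ℕ → ℝ)} (h : IsTestLaw σ' ν')
    (q : H →ₗ.[ℝ] ℝ) (φ : HilbertBasis ℕ ℝ H) (hq : ∀ j, φ j ∈ q.domain) {l m : ℕ → ℝ}
    (hl : Summable (ptoTerm q (diagOp φ l) φ h.memLp))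
    (hsum : Summable fun j => evalExt q (φ j) ^ 2 * σ' j * (l j - m j) ^ 2) :
    Summable (ptoTerm q (diagOp φ m) φ h.memLp) := by
  have hd := (h.summable_ptoTerm_iff q φ hq fun j => l j - m j).2 hsum
  refine (hl.sub hd).congr fun j => ?_
  simp only [ptoTerm_diagOp q φ hq, ← sub_smul]
  ring_nf

/-- No convergence is assumed for `m`: a finite right side forces it, by subtracting the error
series from that of `l`, and an infinite one makes the bound trivial. The default value of a
divergent `tsum` is therefore harmless. -/
theorem IsTestLaw.lintegral_pto_sub_le {σ' : ℕ → ℝ} {ν' : Measure (ℕ → ℝ)} (h : IsTestLaw σ' ν')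
    (q : H →ₗ.[ℝ] ℝ) (φ : HilbertBasis ℕ ℝ H) (hq : ∀ j, φ j ∈ q.domain) {l : ℕ → ℝ}
    (hl : Summable (ptoTerm q (diagOp φ l) φ h.memLp)) (m : ℕ → ℝ) :
    ∫⁻ x, ‖pto q (diagOp φ l) φ h.memLp x - pto q (diagOp φ m) φ h.memLp x‖ₑ ^ 2 ∂ν'
      ≤ ∑' j, ENNReal.ofReal (evalExt q (φ j) ^ 2 * σ' j * (l j - m j) ^ 2) := by
  have hnn : ∀ j, 0 ≤ evalExt q (φ j) ^ 2 * σ' j * (l j - m j) ^ 2 := fun j => by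
    have := h.variance_nonneg j
    positivity
  by_cases htop : ∑' j, ENNReal.ofReal (evalExt q (φ j) ^ 2 * σ' j * (l j - m j) ^ 2) = ∞
  · rw [htop]; exact le_top
  have hsum : Summable fun j => evalExt q (φ j) ^ 2 * σ' j * (l j - m j) ^ 2 :=
    h.summable_error_of_ne_top htop
  have hm := h.summable_ptoTerm_of_sub q φ hq hl hsum
  have hdiff : pto q (diagOp φ l) φ h.memLp - pto q (diagOp φ m) φ h.memLp
      = ∑' j, (evalExt q (φ j) * (l j - m j)) • (h.memLp j).toLp _ := by
    rw [pto, pto, ← hl.tsum_sub hm]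
    refine tsum_congr fun j => ?_
    rw [ptoTerm_diagOp q φ hq, ptoTerm_diagOp q φ hq, ← sub_smul]
    ring_nf
  calc _ = ∫⁻ x, ‖(pto q (diagOp φ l) φ h.memLp - pto q (diagOp φ m) φ h.memLp : Lp ℝ 2 ν') x‖ₑ ^ 2
        ∂ν' := by
        refine lintegral_congr_ae ?_
        filter_upwards [Lp.coeFn_sub (pto q (diagOp φ l) φ h.memLp)
          (pto q (diagOp φ m) φ h.memLp)] with x hx
        rw [hx, Pi.sub_apply]
    _ ≤ _ := by
        rw [lintegral_enorm_sq_eq, hdiff, ← ENNReal.ofReal_tsum_of_nonneg hnn hsum]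
        refine ENNReal.ofReal_le_ofReal ?_
        have h2 := norm_tsum_smul_orthogonal_sq_le (e := fun j => (h.memLp j).toLp _)
          (fun j k hjk => by rw [h.inner_toLp, if_neg hjk])
          (a := fun j => evalExt q (φ j) * (l j - m j))
          (by simp only [h.norm_toLp_sq]; exact hsum.congr fun j => by ring)
        refine h2.trans_eq (tsum_congr fun j => ?_)
        rw [h.norm_toLp_sq]
        ring

/-! ### Averaging over the noise -/

variable {Ω : Type*} [MeasurableSpace Ω] {P : Measure Ω}

theorem IsWhiteNoise.memLp_two {ξ : H → Ω → ℝ} (h : IsWhiteNoise ξ P) (g : H) :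
    MemLp (ξ g) 2 P :=
  (h.gaussian.hasGaussianLaw_eval g).memLp_two

theorem integral_noise_mul {η : ℕ → H → Ω → ℝ} (hη : ∀ n, IsWhiteNoise (η n) P)
    (hind : iIndepFun (fun n ω (h : H) => η n h ω) P) {g : H} (hg : ‖g‖ = 1) (m n : ℕ) :
    ∫ ω, η m g ω * η n g ω ∂P = if m = n then 1 else 0 := by
  split_ifs with hmn
  · rw [hmn, (hη n).cov, real_inner_self_eq_norm_sq, hg, one_pow]
  · have hi : (η m g) ⟂ᵢ[P] (η n g) :=
      (hind.indepFun hmn).comp (φ := fun f : H → ℝ => f g) (ψ := fun f : H → ℝ => f g)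
        (measurable_pi_apply g) (measurable_pi_apply g)
    have h := hi.integral_mul_eq_mul_integral ((hη m).memLp_two g).1 ((hη n).memLp_two g).1
    rw [(hη m).centered g, zero_mul] at h
    exact h

/-- The noise sum is centered with variance `∑ x n ^ 2`, so the cross term vanishes. -/
theorem lintegral_noise_sq [IsProbabilityMeasure P] {η : ℕ → H → Ω → ℝ}
    (hη : ∀ n, IsWhiteNoise (η n) P)
    (hind : iIndepFun (fun n ω (h : H) => η n h ω) P) {g : H} (hg : ‖g‖ = 1) {N : ℕ}
    (a b : ℝ) (x : Fin N → ℝ) :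
    ∫⁻ ω, ENNReal.ofReal ((a - b * ∑ n, x n * η n g ω) ^ 2) ∂P
      = ENNReal.ofReal (a ^ 2 + b ^ 2 * ∑ n, x n ^ 2) := by
  set Z : Ω → ℝ := fun ω => ∑ n, x n * η n g ω with hZ
  have hZm : MemLp Z 2 P := memLp_finsetSum _ fun n _ => ((hη n).memLp_two g).const_mul (x n)
  have hZ0 : ∫ ω, Z ω ∂P = 0 := by
    rw [hZ, integral_finsetSum _ fun (n : Fin N) _ =>
      (((hη n).memLp_two g).integrable one_le_two).const_mul (x n)]
    simp [integral_const_mul, (hη _).centered]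
  have hZ2 : ∫ ω, Z ω ^ 2 ∂P = ∑ n, x n ^ 2 := by
    have hint : ∀ m n : Fin N, Integrable (fun ω => x m * x n * (η m g ω * η n g ω)) P :=
      fun m n => (((hη m).memLp_two g).integrable_mul ((hη n).memLp_two g)).const_mul _
    have e : ∀ ω, Z ω ^ 2 = ∑ m, ∑ n, x m * x n * (η m g ω * η n g ω) := by
      intro ω
      rw [hZ, sq, Finset.sum_mul_sum]
      exact Finset.sum_congr rfl fun m _ => Finset.sum_congr rfl fun n _ => by ring
    simp only [e]
    rw [integral_finsetSum _ fun m _ => integrable_finsetSum _ fun n _ => hint m n]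
    refine Finset.sum_congr rfl fun m _ => ?_
    rw [integral_finsetSum _ fun n _ => hint m n]
    simp only [integral_const_mul, integral_noise_mul hη hind hg]
    simp [← Fin.ext_iff, sq]
  have hint : Integrable (fun ω => (a - b * Z ω) ^ 2) P :=
    ((memLp_const a).sub (hZm.const_mul b)).integrable_sq
  rw [← ofReal_integral_eq_lintegral_ofReal hint (Eventually.of_forall fun _ => sq_nonneg _)]
  congr 1
  have e : ∀ ω, (a - b * Z ω) ^ 2 = (a ^ 2 - 2 * a * b * Z ω) + b ^ 2 * Z ω ^ 2 :=
    fun ω => by ring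
  simp only [e]
  have i1 := (hZm.integrable one_le_two).const_mul (2 * a * b)
  have i2 := hZm.integrable_sq.const_mul (b ^ 2)
  rw [integral_add (f := fun ω => a ^ 2 - 2 * a * b * Z ω) ((integrable_const _).sub i1) i2, integral_sub (integrable_const _) i1,
    integral_const_mul, integral_const_mul, hZ0, hZ2]
  simp

/-- The mean squared error of the posterior mean of one eigenvalue, with prior variance `m`, truth
`a` and empirical input energy `s`. -/
noncomputable def eigenvalueRisk (a m s : ℝ) : ℝ := (a ^ 2 + m ^ 2 * s) / (1 + m * s) ^ 2

/-- Tonelli reduces the claim to one coordinate at a time. Measurability is recorded too, for the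
passage from a finite expectation to almost sure finiteness. -/
theorem lintegral_tsum_error [IsProbabilityMeasure P] {η : ℕ → H → Ω → ℝ}
    (hη : ∀ n, IsWhiteNoise (η n) P) (hind : iIndepFun (fun n ω (h : H) => η n h ω) P)
    (φ : HilbertBasis ℕ ℝ H) {μ : ℕ → ℝ≥0} (hμ : ∀ j, 0 < μ j) (l : ℕ → ℝ) {N : ℕ}
    {U : Fin N → H} (hU : ∀ n, U n ∈ (diagOp φ l).domain) {w : ℕ → ℝ} (hw : ∀ j, 0 ≤ w j) :
    (∀ j, AEMeasurable (fun ω => ENNReal.ofReal (w j * (l j - posteriorMeanEigenvalue φ μ U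
      (fullFieldData (diagOp φ l) U fun n h => η n h ω) j) ^ 2)) P) ∧
    ∫⁻ ω, ∑' j, ENNReal.ofReal (w j * (l j - posteriorMeanEigenvalue φ μ U
      (fullFieldData (diagOp φ l) U fun n h => η n h ω) j) ^ 2) ∂P
      = ∑' j, ENNReal.ofReal (w j * eigenvalueRisk (l j) (μ j) (∑ n, ⟪φ j, U n⟫ ^ 2)) := by
  have hη_meas : ∀ (n : ℕ) (g : H), AEMeasurable (η n g) P := fun n g =>
    ((hη n).memLp_two g).1.aemeasurable
  simp only [posteriorMeanEigenvalue_fullFieldData φ hμ l hU]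
  have hm : ∀ j, AEMeasurable (fun ω => ENNReal.ofReal (w j * ((l j - μ j *
      ∑ n, ⟪φ j, U n⟫ * η n (φ j) ω) / (1 + μ j * ∑ n, ⟪φ j, U n⟫ ^ 2)) ^ 2)) P := by
    intro j
    have h1 : AEMeasurable (fun ω => ∑ n : Fin N, ⟪φ j, U n⟫ * η n (φ j) ω) P :=
      Finset.aemeasurable_fun_sum _ fun n _ => (hη_meas n (φ j)).const_mul _
    exact ((((h1.const_mul _).const_sub _).div_const _).pow_const 2).const_mul _ |>.ennreal_ofReal
  refine ⟨hm, ?_⟩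
  rw [lintegral_tsum hm]
  refine tsum_congr fun j => ?_
  have hA : 0 ≤ ∑ n, ⟪φ j, U n⟫ ^ 2 := Finset.sum_nonneg fun _ _ => sq_nonneg _
  have h1 : 0 < 1 + (μ j : ℝ) * ∑ n, ⟪φ j, U n⟫ ^ 2 := by positivity
  set d := 1 + (μ j : ℝ) * ∑ n, ⟪φ j, U n⟫ ^ 2 with hd
  have e : ∀ ω, ENNReal.ofReal (w j * ((l j - μ j * ∑ n, ⟪φ j, U n⟫ * η n (φ j) ω) / d) ^ 2)
      = ENNReal.ofReal (w j / d ^ 2)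
        * ENNReal.ofReal ((l j - μ j * ∑ n, ⟪φ j, U n⟫ * η n (φ j) ω) ^ 2) := fun ω => by
    rw [← ENNReal.ofReal_mul (div_nonneg (hw j) (by positivity))]
    congr 1
    field_simp
  simp only [e]
  rw [lintegral_const_mul' _ _ ENNReal.ofReal_ne_top,
    lintegral_noise_sq hη hind (φ.orthonormal.1 j),
    ← ENNReal.ofReal_mul (div_nonneg (hw j) (by positivity)), eigenvalueRisk, ← hd]
  congr 1
  field_simp

end Hilbert

/-! ### Exponential concentration for independent samples -/

section Concentration

variable {X : Type*} [MeasurableSpace X] {ν : Measure X}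

/-- The exponent `ℓ = 2k` in the supremum gives an `L^(2k)` norm of at most `K √(2k)`. -/
theorem lintegral_pow_le_of_subgaussianNorm_le {z : X → ℝ} {K : ℝ} (hK : 0 ≤ K)
    (hz : subgaussianNorm z ν ≤ ENNReal.ofReal K) {k : ℕ} (hk : 1 ≤ k) :
    ∫⁻ u, ENNReal.ofReal (z u ^ (2 * k)) ∂ν ≤ ENNReal.ofReal ((2 * K ^ 2 * k) ^ k) := by
  have hk' : (1 : ℝ) ≤ k := by exact_mod_cast hk
  have h2 : (1 : ℝ) ≤ (2 * k : ℕ) := by push_cast; linarith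
  have h1 : eLpNorm z (ENNReal.ofReal (2 * k : ℕ)) ν / ENNReal.ofReal √(2 * k : ℕ)
      ≤ ENNReal.ofReal K := by
    refine le_trans ?_ hz
    rw [subgaussianNorm]
    exact le_iSup₂ (f := fun (ℓ : ℝ) (_ : 1 ≤ ℓ) =>
      eLpNorm z (ENNReal.ofReal ℓ) ν / ENNReal.ofReal (Real.sqrt ℓ)) _ h2
  rw [ENNReal.div_le_iff (by simpa using (by omega : 0 < k)) ENNReal.ofReal_ne_top, ← ENNReal.ofReal_mul hK,
    ENNReal.ofReal_natCast] at h1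
  have h3 := eLpNorm_nnreal_pow_eq_lintegral (f := z) (μ := ν) (p := (2 * k : ℕ))
    (by simp; omega)
  have h4 : ∀ u, ENNReal.ofReal (z u ^ (2 * k)) = ‖z u‖ₑ ^ (((2 * k : ℕ) : ℝ≥0) : ℝ) := fun u => by
    rw [NNReal.coe_natCast, ENNReal.rpow_natCast, ← ofReal_norm, Real.norm_eq_abs,
      ← ENNReal.ofReal_pow (abs_nonneg _), Even.pow_abs (even_two_mul k)]
  simp only [h4, ← h3]
  rw [NNReal.coe_natCast, ENNReal.rpow_natCast, ENNReal.coe_natCast]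
  refine (pow_le_pow_left' h1 _).trans_eq ?_
  rw [← ENNReal.ofReal_pow (by positivity), pow_mul, mul_pow, Real.sq_sqrt (by positivity)]
  push_cast
  ring_nf

variable [IsProbabilityMeasure ν]

/-- Chernoff's bound for a sum over independent samples. -/
theorem measure_pi_sum_ge_le {f : X → ℝ} (hf : Measurable f) {a : ℝ}
    (ha : ∫⁻ u, ENNReal.ofReal (Real.exp (f u)) ∂ν ≤ ENNReal.ofReal (Real.exp a)) (b : ℝ) (N : ℕ) :
    (Measure.pi fun _ : Fin N => ν) {U | b * N ≤ ∑ n, f (U n)}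
      ≤ ENNReal.ofReal (Real.exp ((a - b) * N)) := by
  set g : X → ℝ≥0∞ := fun u => ENNReal.ofReal (Real.exp (f u)) with hg
  have hgm : Measurable g := hf.exp.ennreal_ofReal
  have hind : iIndepFun (fun (n : Fin N) (U : Fin N → X) => g (U n)) (Measure.pi fun _ => ν) :=
    iIndepFun_pi fun _ => hgm.aemeasurable
  have hprod : ∫⁻ U, ∏ n, g (U n) ∂(Measure.pi fun _ : Fin N => ν)
      ≤ ENNReal.ofReal (Real.exp (a * N)) := by
    rw [lintegral_prod_eq_prod_lintegral_of_indepFun _ _ hind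
      fun n => hgm.comp (measurable_pi_apply n)]
    have h1 : ∀ n : Fin N, ∫⁻ U, g (U n) ∂(Measure.pi fun _ : Fin N => ν) = ∫⁻ u, g u ∂ν :=
      fun n => (measurePreserving_eval (fun _ : Fin N => ν) n).lintegral_comp hgm
    simp only [h1, Finset.prod_const, Finset.card_univ, Fintype.card_fin]
    refine (pow_le_pow_left' ha N).trans_eq ?_
    rw [← ENNReal.ofReal_pow (Real.exp_pos _).le, ← Real.exp_nat_mul, mul_comm]
  have hsub : {U : Fin N → X | b * N ≤ ∑ n, f (U n)}
      ⊆ {U | ENNReal.ofReal (Real.exp (b * N)) ≤ ∏ n, g (U n)} := by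
    intro U hU
    simp only [Set.mem_ofPred_eq, hg] at hU ⊢
    rw [← ENNReal.ofReal_prod_of_nonneg fun _ _ => (Real.exp_pos _).le, ← Real.exp_sum]
    exact ENNReal.ofReal_le_ofReal (Real.exp_le_exp.2 hU)
  have hb : ENNReal.ofReal (Real.exp (b * N)) ≠ 0 := by
    simpa using Real.exp_pos _
  calc _ ≤ _ := measure_mono hsub
    _ ≤ (∫⁻ U, ∏ n, g (U n) ∂(Measure.pi fun _ : Fin N => ν)) / ENNReal.ofReal (Real.exp (b * N)) :=
        meas_ge_le_lintegral_div
          (Finset.measurable_fun_prod _ fun n _ => hgm.comp (measurable_pi_apply n)).aemeasurable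
          hb ENNReal.ofReal_ne_top
    _ ≤ ENNReal.ofReal (Real.exp (a * N)) / ENNReal.ofReal (Real.exp (b * N)) := by gcongr
    _ = _ := by
        rw [← ENNReal.ofReal_div_of_pos (Real.exp_pos _), ← Real.exp_sub, sub_mul]

/-- Expand the exponential and insert the even moments: `k^k / k! ≤ e^k` bounds the series by the
geometric series of ratio `1/2`. -/
theorem lintegral_exp_sq_le_two {z : X → ℝ} (hzm : Measurable z) {K c : ℝ} (hK : 0 ≤ K)
    (hz : subgaussianNorm z ν ≤ ENNReal.ofReal K) (hc : 0 ≤ c)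
    (hcK : c * (2 * K ^ 2) * Real.exp 1 ≤ 1 / 2) :
    ∫⁻ u, ENNReal.ofReal (Real.exp (c * z u ^ 2)) ∂ν ≤ 2 := by
  have hexp : ∀ u, ENNReal.ofReal (Real.exp (c * z u ^ 2))
      = ∑' k : ℕ, ENNReal.ofReal (c ^ k / k.factorial) * ENNReal.ofReal (z u ^ (2 * k)) := by
    intro u
    have h := NormedSpace.expSeries_div_hasSum_exp (c * z u ^ 2)
    rw [← congrFun Real.exp_eq_exp_ℝ _] at h
    rw [← h.tsum_eq, ENNReal.ofReal_tsum_of_nonneg (fun k => by positivity) h.summable]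
    refine tsum_congr fun k => ?_
    rw [← ENNReal.ofReal_mul (by positivity), mul_pow, pow_mul]
    congr 1
    ring
  simp only [hexp]
  rw [lintegral_tsum fun k => ((hzm.pow_const _).ennreal_ofReal.const_mul _).aemeasurable]
  have hterm : ∀ k : ℕ, ∫⁻ u, ENNReal.ofReal (c ^ k / k.factorial) * ENNReal.ofReal (z u ^ (2 * k)) ∂ν
      ≤ ENNReal.ofReal ((1 / 2) ^ k) := by
    intro k
    rw [lintegral_const_mul' _ _ ENNReal.ofReal_ne_top]
    rcases Nat.eq_zero_or_pos k with rfl | hk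
    · simp
    · refine (mul_le_mul_right (lintegral_pow_le_of_subgaussianNorm_le hK hz hk) _).trans ?_
      rw [← ENNReal.ofReal_mul (by positivity)]
      refine ENNReal.ofReal_le_ofReal ?_
      have h1 := Real.pow_div_factorial_le_exp (k : ℝ) (Nat.cast_nonneg k) k
      calc c ^ k / k.factorial * (2 * K ^ 2 * k) ^ k
          = (c * (2 * K ^ 2)) ^ k * ((k : ℝ) ^ k / k.factorial) := by ring
        _ ≤ (c * (2 * K ^ 2)) ^ k * Real.exp k := by gcongr
        _ = (c * (2 * K ^ 2) * Real.exp 1) ^ k := by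
            rw [mul_pow _ (Real.exp 1), ← Real.exp_nat_mul, mul_one]
        _ ≤ _ := by gcongr
  refine (ENNReal.tsum_le_tsum hterm).trans_eq ?_
  rw [← ENNReal.ofReal_tsum_of_nonneg (fun k => by positivity) summable_geometric_two,
    tsum_geometric_two]
  simp

/-- Take reciprocals in `1 + t + t²/2 ≤ exp t`; the product of the two quadratics is `1 + t⁴/4`. -/
theorem exp_neg_le_quadratic {t : ℝ} (ht : 0 ≤ t) : Real.exp (-t) ≤ 1 - t + t ^ 2 / 2 := by
  have h1 := Real.quadratic_le_exp_of_nonneg ht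
  have h2 : 0 < 1 + t + t ^ 2 / 2 := by positivity
  have h3 : 1 ≤ (1 - t + t ^ 2 / 2) * (1 + t + t ^ 2 / 2) := by
    nlinarith [sq_nonneg (t ^ 2)]
  rw [Real.exp_neg, inv_le_iff_one_le_mul₀ (Real.exp_pos t)]
  exact h3.trans (mul_le_mul_of_nonneg_left h1 (by nlinarith [sq_nonneg (t - 1)]))

/-- The empirical second moment of a normalized variable is at least `1 / 2`, up to an
exponentially small probability. -/
theorem measure_pi_sum_sq_le_half {z : X → ℝ} (hzm : Measurable z) (h2 : ∫ u, z u ^ 2 ∂ν = 1)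
    {M : ℝ} (hM : 0 < M) (h4 : ∫⁻ u, ENNReal.ofReal (z u ^ 4) ∂ν ≤ ENNReal.ofReal M) (N : ℕ) :
    (Measure.pi fun _ : Fin N => ν) {U | ∑ n, z (U n) ^ 2 ≤ N / 2}
      ≤ ENNReal.ofReal (Real.exp (-(1 / (8 * M)) * N)) := by
  have hi2 : Integrable (fun u => z u ^ 2) ν := by
    by_contra h
    rw [integral_undef h] at h2
    exact zero_ne_one h2
  have hi4 : Integrable (fun u => z u ^ 4) ν := by
    refine ⟨(hzm.pow_const 4).aestronglyMeasurable, ?_⟩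
    rw [hasFiniteIntegral_iff_ofReal (Eventually.of_forall fun u => by positivity)]
    exact h4.trans_lt ENNReal.ofReal_lt_top
  have h4' : ∫ u, z u ^ 4 ∂ν ≤ M := by
    rw [integral_eq_lintegral_of_nonneg_ae (Eventually.of_forall fun u => by positivity) hi4.1]
    exact ENNReal.toReal_le_of_le_ofReal hM.le h4
  -- This minimizes the Chernoff exponent `-c/2 + c² M/2`, with value `-1/(8M)`.
  set c : ℝ := 1 / (2 * M) with hc
  have hcpos : 0 < c := by positivity
  have hmgf : ∫⁻ u, ENNReal.ofReal (Real.exp (-(c * z u ^ 2))) ∂ν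
      ≤ ENNReal.ofReal (Real.exp (-c + c ^ 2 / 2 * M)) := by
    have hint : Integrable (fun u => 1 - c * z u ^ 2 + c ^ 2 / 2 * z u ^ 4) ν :=
      ((integrable_const 1).sub (hi2.const_mul c)).add (hi4.const_mul _)
    have hle : ∀ u, Real.exp (-(c * z u ^ 2)) ≤ 1 - c * z u ^ 2 + c ^ 2 / 2 * z u ^ 4 := fun u => by
      have := exp_neg_le_quadratic (t := c * z u ^ 2) (by positivity)
      refine this.trans_eq ?_
      ring
    calc _ ≤ ∫⁻ u, ENNReal.ofReal (1 - c * z u ^ 2 + c ^ 2 / 2 * z u ^ 4) ∂ν :=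
          lintegral_mono fun u => ENNReal.ofReal_le_ofReal (hle u)
      _ = ENNReal.ofReal (∫ u, 1 - c * z u ^ 2 + c ^ 2 / 2 * z u ^ 4 ∂ν) :=
          (ofReal_integral_eq_lintegral_ofReal hint
            (Eventually.of_forall fun u => (Real.exp_pos _).le.trans (hle u))).symm
      _ ≤ _ := by
          refine ENNReal.ofReal_le_ofReal ?_
          rw [integral_add (f := fun u => 1 - c * z u ^ 2)
            ((integrable_const 1).sub (hi2.const_mul c)) (hi4.const_mul _),
            integral_sub (integrable_const 1) (hi2.const_mul c), integral_const_mul,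
            integral_const_mul, h2]
          have h5 : c ^ 2 / 2 * ∫ u, z u ^ 4 ∂ν ≤ c ^ 2 / 2 * M := by gcongr
          have h6 := Real.add_one_le_exp (-c + c ^ 2 / 2 * M)
          simp only [integral_const, probReal_univ, smul_eq_mul]
          linarith
  have h := measure_pi_sum_ge_le (hzm.pow_const 2 |>.const_mul c).neg hmgf (-(c / 2)) N
  have e1 : -c + c ^ 2 / 2 * M - -(c / 2) = -(1 / (8 * M)) := by
    rw [hc]; field_simp; ring
  rw [e1] at h
  refine (measure_mono fun U hU => ?_).trans h
  simp only [Set.mem_ofPred_eq, Pi.neg_apply, Finset.sum_neg_distrib, ← Finset.mul_sum] at hU ⊢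
  nlinarith

/-- Convexity of `exp`, with the missing mass `1 - ∑ p` placed at `0`, gives a bound independent of
the size of `s`. -/
theorem lintegral_exp_sum_sq_le_three {z : ℕ → X → ℝ} (hzm : ∀ j, Measurable (z j)) {c : ℝ}
    (hz : ∀ j, ∫⁻ u, ENNReal.ofReal (Real.exp (c * z j u ^ 2)) ∂ν ≤ 2)
    {p : ℕ → ℝ} (hp : ∀ j, 0 ≤ p j) {s : Finset ℕ} (hps : ∑ j ∈ s, p j ≤ 1) :
    ∫⁻ u, ENNReal.ofReal (Real.exp (∑ j ∈ s, p j * (c * z j u ^ 2))) ∂ν ≤ 3 := by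
  have hle : ∀ u, ENNReal.ofReal (Real.exp (∑ j ∈ s, p j * (c * z j u ^ 2)))
      ≤ 1 + ∑ j ∈ s, ENNReal.ofReal (p j) * ENNReal.ofReal (Real.exp (c * z j u ^ 2)) := by
    intro u
    have h := convexOn_exp.map_add_sum_le (t := s) (v := 1 - ∑ j ∈ s, p j) (q := 0)
      (p := fun j => c * z j u ^ 2) (w := p) (fun j _ => hp j) (by ring) (fun _ _ => Set.mem_univ _)
      (by linarith) (Set.mem_univ _)
    simp only [smul_eq_mul, mul_zero, zero_add, Real.exp_zero, mul_one] at h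
    have h0 : 0 ≤ ∑ j ∈ s, p j := Finset.sum_nonneg fun j _ => hp j
    have h1 : Real.exp (∑ j ∈ s, p j * (c * z j u ^ 2))
        ≤ 1 + ∑ j ∈ s, p j * Real.exp (c * z j u ^ 2) := by linarith
    refine (ENNReal.ofReal_le_ofReal h1).trans_eq ?_
    have hnn : ∀ j ∈ s, 0 ≤ p j * Real.exp (c * z j u ^ 2) := fun j _ =>
      mul_nonneg (hp j) (Real.exp_pos _).le
    rw [ENNReal.ofReal_add zero_le_one (Finset.sum_nonneg hnn), ENNReal.ofReal_one,
      ENNReal.ofReal_sum_of_nonneg hnn]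
    simp only [ENNReal.ofReal_mul (hp _)]
  refine (lintegral_mono hle).trans ?_
  have hm : ∀ j, Measurable fun u => ENNReal.ofReal (Real.exp (c * z j u ^ 2)) := fun j =>
    ((hzm j).pow_const 2 |>.const_mul c).exp.ennreal_ofReal
  rw [lintegral_add_left measurable_const,
    lintegral_finsetSum _ fun j _ => (hm j).const_mul _]
  simp only [lintegral_const, measure_univ, mul_one, lintegral_const_mul _ (hm _)]
  calc 1 + ∑ j ∈ s, ENNReal.ofReal (p j) * ∫⁻ u, ENNReal.ofReal (Real.exp (c * z j u ^ 2)) ∂ν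
      ≤ 1 + ∑ j ∈ s, ENNReal.ofReal (p j) * 2 := by gcongr with j _; exact hz j
    _ ≤ 1 + 1 * 2 := by
        rw [← Finset.sum_mul, ← ENNReal.ofReal_sum_of_nonneg fun j _ => hp j]
        gcongr
        simpa using hps
    _ = 3 := by norm_num

/-- Weighted sums of empirical second moments are bounded, up to an exponentially small
probability. -/
theorem measure_pi_weighted_sum_sq_ge {z : ℕ → X → ℝ} (hzm : ∀ j, Measurable (z j)) {c : ℝ}
    (hc : 0 < c) (hz : ∀ j, ∫⁻ u, ENNReal.ofReal (Real.exp (c * z j u ^ 2)) ∂ν ≤ 2)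
    {Q : ℕ → ℝ} (hQ : ∀ j, 0 ≤ Q j) {A : ℝ} (hA : 0 < A)
    (hQA : ∀ k, ∑ j ∈ Finset.range k, Q j ≤ A) (N : ℕ) :
    (Measure.pi fun _ : Fin N => ν)
        {U | ∃ k, 3 * A / c * N ≤ ∑ j ∈ Finset.range k, Q j * ∑ n, z j (U n) ^ 2}
      ≤ ENNReal.ofReal (Real.exp (-N)) := by
  rw [Set.ofPred_exists]
  -- The events increase with `k`, so the union over all `k` costs nothing.
  have hmono : Monotone fun k => {U : Fin N → X |
      3 * A / c * N ≤ ∑ j ∈ Finset.range k, Q j * ∑ n, z j (U n) ^ 2} := by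
    intro k k' hkk U hU
    refine le_trans (Set.mem_ofPred_eq ▸ hU) (Finset.sum_le_sum_of_subset_of_nonneg
      (Finset.range_mono hkk) fun j _ _ => ?_)
    exact mul_nonneg (hQ j) (Finset.sum_nonneg fun _ _ => sq_nonneg _)
  rw [hmono.measure_iUnion]
  refine iSup_le fun k => ?_
  have hmgf := lintegral_exp_sum_sq_le_three (ν := ν) hzm hz (p := fun j => Q j / A)
    (fun j => div_nonneg (hQ j) hA.le) (s := Finset.range k)
    (by rw [← Finset.sum_div, div_le_one hA]; exact hQA k)
  -- Log-moment `2` against level `3` yields the Chernoff exponent `-N`; undoing the factor `c / A`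
  -- turns this level into `3 * A / c`.
  have h3 : (3 : ℝ≥0∞) ≤ ENNReal.ofReal (Real.exp 2) := by
    have : (3 : ℝ) ≤ Real.exp 2 := by linarith [Real.add_one_le_exp (2 : ℝ)]
    calc (3 : ℝ≥0∞) = ENNReal.ofReal 3 := by simp
      _ ≤ _ := ENNReal.ofReal_le_ofReal this
  have hfm : Measurable fun u => ∑ j ∈ Finset.range k, Q j / A * (c * z j u ^ 2) :=
    Finset.measurable_fun_sum _ fun j _ => (((hzm j).pow_const 2).const_mul c).const_mul _
  have h := measure_pi_sum_ge_le hfm (hmgf.trans h3) 3 N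
  have e1 : ((2 : ℝ) - 3) * N = -N := by ring
  rw [e1] at h
  refine (measure_mono fun U hU => ?_).trans h
  simp only [Set.mem_ofPred_eq] at hU ⊢
  have e2 : ∑ n, ∑ j ∈ Finset.range k, Q j / A * (c * z j (U n) ^ 2)
      = c / A * ∑ j ∈ Finset.range k, Q j * ∑ n, z j (U n) ^ 2 := by
    rw [Finset.sum_comm, Finset.mul_sum]
    refine Finset.sum_congr rfl fun j _ => ?_
    simp only [Finset.mul_sum]
    exact Finset.sum_congr rfl fun n _ => by ring
  rw [e2]
  calc 3 * (N : ℝ) = c / A * (3 * A / c * N) := by field_simp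
    _ ≤ _ := by gcongr

end Concentration

/-! ### Power weights and the deterministic risk bound -/

theorem powSeq_pos (p : ℝ) (j : ℕ) : 0 < powSeq p j := Real.rpow_pos_of_pos (by positivity) _

theorem powSeq_mul (p p' : ℝ) (j : ℕ) : powSeq p j * powSeq p' j = powSeq (p + p') j :=
  (Real.rpow_add (by positivity) _ _).symm

theorem powSeq_zero (j : ℕ) : powSeq 0 j = 1 := Real.rpow_zero _

theorem powSeq_neg (p : ℝ) (j : ℕ) : powSeq (-p) j = (powSeq p j)⁻¹ :=
  Real.rpow_neg (by positivity) _

theorem powSeq_le_powSeq {p p' : ℝ} (h : p ≤ p') (j : ℕ) : powSeq p j ≤ powSeq p' j :=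
  Real.rpow_le_rpow_of_exponent_le (by simp) h

theorem powSeq_rpow (p p' : ℝ) (j : ℕ) : powSeq p j ^ p' = powSeq (p * p') j :=
  (Real.rpow_mul (by positivity) _ _).symm

/-- The finitely many exceptional ratios are absorbed into the constant by adding them all. -/
theorem AsympLE.exists_bound {a : ℕ → ℝ} {p : ℝ} (h : AsympLE a (powSeq p)) :
    ∃ C : ℝ, 0 < C ∧ ∀ j, a j ≤ C * powSeq p j := by
  obtain ⟨c, hc, h⟩ := h
  obtain ⟨J, hJ⟩ := eventually_atTop.1 h
  have hnn : ∀ i, 0 ≤ |a i| / powSeq p i := fun i => div_nonneg (abs_nonneg _) (powSeq_pos p i).le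
  have hS : 0 ≤ ∑ i ∈ Finset.range J, |a i| / powSeq p i := Finset.sum_nonneg fun i _ => hnn i
  refine ⟨c + ∑ i ∈ Finset.range J, |a i| / powSeq p i, by positivity, fun j => ?_⟩
  have hp := powSeq_pos p j
  rcases le_or_gt J j with hj | hj
  · exact (hJ j hj).trans (by gcongr; linarith)
  · have h1 := Finset.single_le_sum (fun i _ => hnn i) (Finset.mem_range.2 hj)
    calc a j ≤ |a j| := le_abs_self _
      _ = |a j| / powSeq p j * powSeq p j := by field_simp
      _ ≤ _ := by gcongr; linarith

theorem AsympEquiv.exists_bounds {a : ℕ → ℝ} (ha : ∀ j, 0 < a j) {p : ℝ}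
    (h : AsympEquiv a (powSeq p)) :
    ∃ C : ℝ, 0 < C ∧ ∀ j, a j ≤ C * powSeq p j ∧ powSeq p j ≤ C * a j := by
  obtain ⟨c, hc, h⟩ := h
  have hc0 : 0 < c := by linarith
  obtain ⟨C₁, hC₁, h₁⟩ := AsympLE.exists_bound (a := a) (p := p) ⟨c, hc0, h.mono fun j hj => hj.2⟩
  obtain ⟨C₂, hC₂, h₂⟩ := AsympLE.exists_bound (a := fun j => (a j)⁻¹) (p := -p)
    ⟨c, hc0, h.mono fun j hj => by
      rw [powSeq_neg, inv_le_iff_one_le_mul₀ (ha j)]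
      have hp := powSeq_pos p j
      have := hj.1
      field_simp at this ⊢
      linarith⟩
  refine ⟨C₁ + C₂, by positivity, fun j => ⟨(h₁ j).trans ?_, ?_⟩⟩
  · have := powSeq_pos p j
    gcongr
    linarith
  · have h := h₂ j
    have hp := powSeq_pos p j
    have haj := ha j
    rw [powSeq_neg, inv_le_iff_one_le_mul₀ haj] at h
    have h3 : powSeq p j ≤ C₂ * a j := by
      field_simp at h
      linarith
    exact h3.trans (by gcongr; linarith)

/-- For prior-dominated indices, where `m * s` may be small; the next bound serves the
data-dominated ones. -/
theorem eigenvalueRisk_le {a m s : ℝ} (hm : 0 ≤ m) (hs : 0 ≤ s) :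
    eigenvalueRisk a m s ≤ a ^ 2 + m ^ 2 * s := by
  have h1 : 0 ≤ m * s := mul_nonneg hm hs
  exact div_le_self (by positivity) (by nlinarith)

theorem eigenvalueRisk_le_of_pos {a m s : ℝ} (hm : 0 < m) (hs : 0 < s) :
    eigenvalueRisk a m s ≤ a ^ 2 / (m * s) ^ 2 + 1 / s := by
  have h1 : 0 < m * s := mul_pos hm hs
  calc eigenvalueRisk a m s ≤ (a ^ 2 + m ^ 2 * s) / (m * s) ^ 2 := by
        rw [eigenvalueRisk]
        gcongr
        linarith
    _ = _ := by field_simp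

/-- The squared error rate is governed by the larger of the parametric rate `N⁻¹` and `N ^ (-θ)`. -/
theorem max_rate_le {α α' β r : ℝ} (hκ : 0 < 1 + 2 * α + 2 * β) {N : ℕ} (hN : 3 ≤ N) :
    max (N : ℝ)⁻¹ ((N : ℝ) ^ (-((2 * α' + 2 * β + 2 * r) / (1 + 2 * α + 2 * β))))
      ≤ rate α α' β r N := by
  have hN' : (3 : ℝ) ≤ N := by exact_mod_cast hN
  have hN1 : (1 : ℝ) ≤ N := by linarith
  rw [rate, ← Real.rpow_neg_one]
  split_ifs with h1 h2
  · refine max_le (Real.rpow_le_rpow_of_exponent_le hN1 ?_) le_rfl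
    rw [neg_le_neg_iff, div_le_one hκ]
    linarith
  · have hθ : (2 * α' + 2 * β + 2 * r) / (1 + 2 * α + 2 * β) = 1 := by
      rw [div_eq_one_iff_eq hκ.ne']
      linarith
    rw [hθ, max_self]
    -- At the boundary `θ = 1`, and `1 ≤ log N` because `N ≥ 3 > e`.
    refine le_mul_of_one_le_right (by positivity) ?_
    rw [Real.le_log_iff_exp_le (by linarith)]
    exact (Real.exp_one_lt_d9.le.trans (by norm_num)).trans hN'
  · refine max_le le_rfl (Real.rpow_le_rpow_of_exponent_le hN1 ?_)
    rw [neg_le_neg_iff, one_le_div hκ]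
    have : α + 1 / 2 ≤ α' + r := not_lt.1 h1
    linarith

/-- The left side is `x^(1-θ) / y`, monotone in `x`, hence extremal at `x = y` or `x = 1` according
to the sign of `1 - θ`. -/
theorem rpow_one_sub_div_le_max {x y θ : ℝ} (hx : 1 ≤ x) (hxy : x ≤ y) :
    x ^ (-θ) * (x / y) ≤ max y⁻¹ (y ^ (-θ)) := by
  have hx0 : 0 < x := by linarith
  have hy0 : 0 < y := by linarith
  have e : ∀ t : ℝ, 0 < t → t ^ (-θ) * (t / y) = t ^ (1 - θ) * y⁻¹ := fun t ht => by
    rw [sub_eq_add_neg, Real.rpow_add ht, Real.rpow_one]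
    ring
  rcases le_total θ 1 with h | h
  · refine le_trans ?_ (le_max_right _ _)
    calc _ = x ^ (1 - θ) * y⁻¹ := e x hx0
      _ ≤ y ^ (1 - θ) * y⁻¹ := by
          gcongr
      _ = y ^ (-θ) := by rw [← e y hy0, div_self hy0.ne', mul_one]
  · refine le_trans ?_ (le_max_left _ _)
    rw [e x hx0]
    exact mul_le_of_le_one_left (by positivity) (Real.rpow_le_one_of_one_le_of_nonpos hx (by linarith))

/-- The contribution of one eigenvalue to the risk, with sample energy `s = σ R`. -/
theorem weighted_risk_le {α α' β r c : ℝ} (hκ : 0 < α + β) (hθ : 0 < α' + r + β) (hc : 1 ≤ c)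
    {j N : ℕ} (hN : 1 ≤ N) {σ σ' a m b R : ℝ} (hσ0 : 0 < σ) (hm0 : 0 < m)
    (hσ : σ ≤ c * powSeq (-2 * α) j) (hσ₂ : powSeq (-2 * α) j ≤ c * σ)
    (hσ' : σ' ≤ c * powSeq (-2 * α') j)
    (hm : m ≤ c * powSeq (-2 * β - 1) j) (hm₂ : powSeq (-2 * β - 1) j ≤ c * m)
    (ha : a ^ 2 ≤ c * powSeq (-2 * β) j) (hR : 0 ≤ R) (hhead : j < N → (N : ℝ) / 2 ≤ R) :
    b ^ 2 * σ' * eigenvalueRisk a m (σ * R)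
      ≤ 6 * c ^ 6 *
        max (N : ℝ)⁻¹ ((N : ℝ) ^ (-((2 * α' + 2 * β + 2 * r) / (1 + 2 * α + 2 * β))))
        * (powSeq (2 * r) j * b ^ 2 * (1 + R / N)) := by
  set κ := 1 + 2 * α + 2 * β with hκdef
  set θ := (2 * α' + 2 * β + 2 * r) / κ with hθdef
  have hκ0 : 0 < κ := by linarith
  have hθ0 : 0 < θ := div_pos (by linarith) hκ0
  have hκθ : κ * θ = 2 * α' + 2 * β + 2 * r := by rw [hθdef]; field_simp
  have hN1 : (1 : ℝ) ≤ N := by exact_mod_cast hN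
  have hN0 : (0 : ℝ) < N := by linarith
  have hc0 : 0 < c := by linarith
  -- Up to constants `1/x` is `m * σ`, so comparing `x` with `N` decides whether data or prior
  -- dominates.
  set x := powSeq κ j with hx
  have hx1 : 1 ≤ x := by
    rw [← powSeq_zero j]
    exact powSeq_le_powSeq hκ0.le j
  have hx0 : 0 < x := by linarith
  set Q := powSeq (2 * r) j * b ^ 2 with hQ
  have hQ0 : 0 ≤ Q := mul_nonneg (powSeq_pos _ _).le (sq_nonneg _)
  set D := max (N : ℝ)⁻¹ ((N : ℝ) ^ (-θ)) with hD
  have hD0 : 0 < D := lt_max_of_lt_left (by positivity)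
  have hxθ : powSeq (-2 * r - 2 * α') j * powSeq (-2 * β) j = x ^ (-θ) := by
    rw [powSeq_mul, hx, powSeq_rpow]
    congr 1
    linarith
  have hb : b ^ 2 * σ' ≤ c * Q * powSeq (-2 * r - 2 * α') j := by
    calc b ^ 2 * σ' ≤ b ^ 2 * (c * powSeq (-2 * α') j) := by gcongr
      _ = c * b ^ 2 * (powSeq (2 * r) j * powSeq (-2 * r - 2 * α') j) := by
          rw [powSeq_mul]; ring_nf
      _ = _ := by rw [hQ]; ring
  have hr0 := powSeq_pos (-2 * r - 2 * α') j
  have hβ0 := powSeq_pos (-2 * β) j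
  have hα0 := powSeq_pos (-2 * α) j
  have hm0' := powSeq_pos (-2 * β - 1) j
  rcases le_or_gt x N with hxN | hxN
  -- Since `κ ≥ 1`, every data-dominated index is among the first `N`, where `R ≥ N/2` is available.
  · have hjN : j < N := by
      have h1 : powSeq 1 j ≤ x := powSeq_le_powSeq (by linarith) j
      rw [powSeq, Real.rpow_one] at h1
      exact_mod_cast (by linarith : (j : ℝ) + 1 ≤ N)
    have hRN := hhead hjN
    have hR0 : 0 < R := by linarith
    have hs0 : 0 < σ * R := mul_pos hσ0 hR0
    have hms : N / (2 * c ^ 2 * x) ≤ m * (σ * R) := by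
      have hxe : x⁻¹ = powSeq (-2 * β - 1) j * powSeq (-2 * α) j := by
        rw [powSeq_mul, hx, ← powSeq_neg]
        congr 1
        rw [hκdef]; ring
      calc N / (2 * c ^ 2 * x) = x⁻¹ * (N / 2) / c ^ 2 := by field_simp
        _ ≤ (c * m) * (c * σ) * R / c ^ 2 := by rw [hxe]; gcongr
        _ = _ := by field_simp
    have h1 : a ^ 2 / (m * (σ * R)) ^ 2 ≤ 4 * c ^ 5 * powSeq (-2 * β) j * (x / N) := by
      calc a ^ 2 / (m * (σ * R)) ^ 2
          ≤ (c * powSeq (-2 * β) j) / (N / (2 * c ^ 2 * x)) ^ 2 := by gcongr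
        _ = 4 * c ^ 5 * powSeq (-2 * β) j * (x / N) * (x / N) := by field_simp; ring
        -- The squared bias carries `(x/N)²`; one factor suffices and matches the variance term.
        _ ≤ _ := mul_le_of_le_one_right (by positivity) ((div_le_one hN0).2 hxN)
    have h2 : 1 / (σ * R) ≤ 2 * c * powSeq (-2 * β) j * (x / N) := by
      have hσR : powSeq (-2 * α) j / c * (N / 2) ≤ σ * R := by
        gcongr
        rw [div_le_iff₀ hc0]
        linarith
      have hxα : powSeq (2 * α) j ≤ powSeq (-2 * β) j * x := by
        rw [hx, powSeq_mul]
        exact powSeq_le_powSeq (by rw [hκdef]; linarith) j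
      have hinv : powSeq (2 * α) j = (powSeq (-2 * α) j)⁻¹ := by
        rw [← powSeq_neg]
        congr 1
        ring
      calc 1 / (σ * R) ≤ 1 / (powSeq (-2 * α) j / c * (N / 2)) := by gcongr
        _ = 2 * c * powSeq (2 * α) j / N := by rw [hinv]; field_simp
        _ ≤ 2 * c * (powSeq (-2 * β) j * x) / N := by gcongr
        _ = _ := by ring
    calc b ^ 2 * σ' * eigenvalueRisk a m (σ * R)
        ≤ c * Q * powSeq (-2 * r - 2 * α') j * (4 * c ^ 5 * powSeq (-2 * β) j * (x / N)
            + 2 * c * powSeq (-2 * β) j * (x / N)) := by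
          have := eigenvalueRisk_le_of_pos (a := a) hm0 hs0
          have h0 : 0 ≤ eigenvalueRisk a m (σ * R) := by
            rw [eigenvalueRisk]
            positivity
          exact mul_le_mul hb (this.trans (add_le_add h1 h2)) h0 (by positivity)
      _ = (4 * c ^ 6 + 2 * c ^ 2) * (x ^ (-θ) * (x / N)) * (Q * 1) := by rw [← hxθ]; ring
      _ ≤ (4 * c ^ 6 + 2 * c ^ 6) * D * (Q * (1 + R / N)) := by
          gcongr
          · norm_num
          · exact rpow_one_sub_div_le_max hx1 hxN
          · have : 0 ≤ R / N := by positivity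
            linarith
      _ = _ := by ring
  -- Prior-dominated index: no pointwise control of `R` is available here, so `R/N` stays in the
  -- bound and is summed against `Q` later.
  · have hxθN : x ^ (-θ) ≤ D :=
      (Real.rpow_le_rpow_of_nonpos hN0 hxN.le (by linarith)).trans (le_max_right _ _)
    have h2 : powSeq (-2 * β - 1) j ^ 2 * powSeq (-2 * α) j ≤ powSeq (-2 * β) j * (N : ℝ)⁻¹ := by
      calc powSeq (-2 * β - 1) j ^ 2 * powSeq (-2 * α) j
          ≤ powSeq (-2 * β) j * x⁻¹ := by
            rw [sq, powSeq_mul, powSeq_mul, hx, ← powSeq_neg, powSeq_mul]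
            exact powSeq_le_powSeq (by rw [hκdef]; linarith) j
        _ ≤ _ := by gcongr
    calc b ^ 2 * σ' * eigenvalueRisk a m (σ * R)
        ≤ c * Q * powSeq (-2 * r - 2 * α') j * (c * powSeq (-2 * β) j
            + (c * powSeq (-2 * β - 1) j) ^ 2 * (c * powSeq (-2 * α) j * R)) := by
          have h0 : 0 ≤ eigenvalueRisk a m (σ * R) := by
            rw [eigenvalueRisk]
            positivity
          refine mul_le_mul hb ((eigenvalueRisk_le hm0.le (by positivity)).trans ?_) h0
            (by positivity)
          gcongr
      _ = c ^ 2 * Q * (powSeq (-2 * r - 2 * α') j * powSeq (-2 * β) j)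
          + c ^ 4 * Q * powSeq (-2 * r - 2 * α') j
            * (powSeq (-2 * β - 1) j ^ 2 * powSeq (-2 * α) j) * R := by ring
      _ ≤ c ^ 2 * Q * (powSeq (-2 * r - 2 * α') j * powSeq (-2 * β) j)
          + c ^ 4 * Q * powSeq (-2 * r - 2 * α') j * (powSeq (-2 * β) j * (N : ℝ)⁻¹) * R := by
          gcongr
      _ = c ^ 2 * x ^ (-θ) * Q + c ^ 4 * x ^ (-θ) * (Q * (R / N)) := by rw [← hxθ]; ring
      _ ≤ (6 * c ^ 6) * D * Q + (6 * c ^ 6) * D * (Q * (R / N)) := by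
          have e1 : c ^ 2 ≤ 6 * c ^ 6 := by
            have : c ^ 2 ≤ c ^ 6 := pow_le_pow_right₀ hc (by norm_num)
            nlinarith [pow_pos hc0 6]
          have e2 : c ^ 4 ≤ 6 * c ^ 6 := by
            have : c ^ 4 ≤ c ^ 6 := pow_le_pow_right₀ hc (by norm_num)
            nlinarith [pow_pos hc0 6]
          gcongr
      _ = _ := by ring

/-! ### Concentration of the training inputs -/

section TrainingLaw

variable {H : Type*} [NormedAddCommGroup H] [InnerProductSpace ℝ H]

/-- Half of the exponent absorbs the factor `N` of the union bound. -/
theorem natCast_mul_exp_neg_le {a : ℝ} (ha : 0 < a) (N : ℕ) :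
    N * Real.exp (-a * N) ≤ 2 / a * Real.exp (-(a / 2) * N) := by
  have h := Real.add_one_le_exp (a / 2 * N)
  have e : Real.exp (-a * N) = Real.exp (-(a / 2) * N) * (Real.exp (a / 2 * N))⁻¹ := by
    rw [← Real.exp_neg, ← Real.exp_add]
    congr 1
    ring
  rw [e, mul_left_comm, mul_comm (2 / a)]
  gcongr
  rw [← div_eq_mul_inv, div_le_div_iff₀ (Real.exp_pos _) ha]
  linarith

theorem ae_pi_forall {X : Type*} [MeasurableSpace X] {ν : Measure X} [IsProbabilityMeasure ν]
    {p : X → Prop} (h : ∀ᵐ u ∂ν, p u) (N : ℕ) :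
    ∀ᵐ U ∂(Measure.pi fun _ : Fin N => ν), ∀ n, p (U n) :=
  ae_all_iff.2 fun n => (Measure.quasiMeasurePreserving_eval (fun _ : Fin N => ν) n).ae h

theorem mem_domain_diagOp_iff (φ : HilbertBasis ℕ ℝ H) (l : ℕ → ℝ) (u : H) :
    u ∈ (diagOp φ l).domain ↔ Summable fun j => l j ^ 2 * ⟪φ j, u⟫ ^ 2 := by
  change Memℓp (fun j => l j * ⟪φ j, u⟫) 2 ↔ _
  rw [memℓp_gen_iff (by simp)]
  refine summable_congr fun j => ?_
  simp [mul_pow]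

theorem sum_coeff_sq_eq (φ : HilbertBasis ℕ ℝ H) {s : ℝ} (hs : 0 < s) (j : ℕ) {N : ℕ}
    (U : Fin N → H) :
    ∑ n, ⟪φ j, U n⟫ ^ 2 = s * ∑ n, (⟪φ j, U n⟫ / √s) ^ 2 := by
  rw [Finset.mul_sum]
  refine Finset.sum_congr rfl fun n _ => ?_
  rw [div_pow, Real.sq_sqrt hs.le]
  field_simp

variable [MeasurableSpace H] [BorelSpace H]

theorem measurable_coeff (φ : HilbertBasis ℕ ℝ H) (j : ℕ) : Measurable fun u : H => ⟪φ j, u⟫ :=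
  (continuous_const.inner continuous_id).measurable

variable [CompleteSpace H] {φ : HilbertBasis ℕ ℝ H} {σ : ℕ → ℝ} {ν : Measure H}

/-- The asymptotics give positivity at large indices; monotonicity carries it back to the small
ones. -/
theorem IsTrainingLaw.variance_pos (hν : IsTrainingLaw φ σ ν) {p : ℝ}
    (hσ : AsympEquiv σ (powSeq p)) (j : ℕ) : 0 < σ j := by
  obtain ⟨c, hc, h⟩ := hσ
  obtain ⟨k, hk, hjk⟩ := (h.and (eventually_ge_atTop j)).exists
  have : 0 < c⁻¹ * powSeq p k := mul_pos (by positivity) (powSeq_pos p k)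
  exact (this.trans_le hk.1).trans_le (hν.antitone hjk)

theorem IsTrainingLaw.integral_coeff_sq (hν : IsTrainingLaw φ σ ν) (j : ℕ) :
    ∫ u, ⟪φ j, u⟫ ^ 2 ∂ν = σ j := by
  have := hν.prob
  have h := covarianceOperator_inner hν.memLp (φ j) (φ j)
  rw [hν.cov, inner_smul_left, real_inner_self_eq_norm_sq, φ.orthonormal.1 j] at h
  simp only [← sq] at h
  rw [← h]
  simp

theorem IsTrainingLaw.lintegral_coeff_sq (hν : IsTrainingLaw φ σ ν) {j : ℕ} (hj : 0 < σ j) :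
    ∫⁻ u, ENNReal.ofReal (⟪φ j, u⟫ ^ 2) ∂ν = ENNReal.ofReal (σ j) := by
  rw [← hν.integral_coeff_sq j, ofReal_integral_eq_lintegral_ofReal _
    (Eventually.of_forall fun u => sq_nonneg _)]
  by_contra h
  have := hν.integral_coeff_sq j
  rw [integral_undef h] at this
  exact hj.ne this

/-- Weighted sums of squared coefficients with summable expectations are almost surely finite. -/
theorem IsTrainingLaw.ae_summable_coeff_sq (hν : IsTrainingLaw φ σ ν) (hσ : ∀ j, 0 < σ j)
    {a : ℕ → ℝ} (ha : ∀ j, 0 ≤ a j) (hsum : Summable fun j => a j * σ j) :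
    ∀ᵐ u ∂ν, Summable fun j => a j * ⟪φ j, u⟫ ^ 2 := by
  have hm : ∀ j, AEMeasurable (fun u => ENNReal.ofReal (a j * ⟪φ j, u⟫ ^ 2)) ν := fun j =>
    ((((measurable_coeff φ j).pow_const 2).const_mul _).ennreal_ofReal).aemeasurable
  have hfin : ∫⁻ u, ∑' j, ENNReal.ofReal (a j * ⟪φ j, u⟫ ^ 2) ∂ν ≠ ∞ := by
    rw [lintegral_tsum hm]
    have e : ∀ j, ∫⁻ u, ENNReal.ofReal (a j * ⟪φ j, u⟫ ^ 2) ∂ν = ENNReal.ofReal (a j * σ j) := by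
      intro j
      simp only [ENNReal.ofReal_mul (ha j)]
      rw [lintegral_const_mul' _ _ ENNReal.ofReal_ne_top, hν.lintegral_coeff_sq (hσ j)]
    simp only [e]
    exact hsum.tsum_ofReal_ne_top
  filter_upwards [ae_lt_top' (AEMeasurable.tsum hm) hfin] with u hu
  exact (ENNReal.summable_toReal hu.ne).congr fun j =>
    ENNReal.toReal_ofReal (mul_nonneg (ha j) (sq_nonneg _))

theorem IsTrainingLaw.ae_mem_domain (hν : IsTrainingLaw φ σ ν) (hσ : ∀ j, 0 < σ j)
    {l : ℕ → ℝ} (hsum : Summable fun j => l j ^ 2 * σ j) :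
    ∀ᵐ u ∂ν, u ∈ (diagOp φ l).domain := by
  filter_upwards [hν.ae_summable_coeff_sq hσ (fun j => sq_nonneg (l j)) hsum] with u hu
  exact (mem_domain_diagOp_iff φ l u).2 hu

theorem IsTrainingLaw.exists_subgaussianNorm_le (hν : IsTrainingLaw φ σ ν) :
    ∃ K : ℝ, 0 < K ∧
      ∀ j, subgaussianNorm (fun u : H => ⟪φ j, u⟫ / √(σ j)) ν ≤ ENNReal.ofReal K := by
  refine ⟨(⨆ j, subgaussianNorm (fun u : H => ⟪φ j, u⟫ / √(σ j)) ν).toReal + 1, by positivity,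
    fun j => ?_⟩
  refine (le_iSup (fun j => subgaussianNorm (fun u : H => ⟪φ j, u⟫ / √(σ j)) ν) j).trans ?_
  rw [ENNReal.ofReal_add ENNReal.toReal_nonneg zero_le_one,
    ENNReal.ofReal_toReal hν.subgaussian.ne]
  exact le_self_add

/-- With exponentially small exceptional probability, the empirical second moments of the first `N`
coefficients are bounded below and a weighted sum of all of them is bounded above. -/
theorem IsTrainingLaw.exists_concentration (hν : IsTrainingLaw φ σ ν) (hσ : ∀ j, 0 < σ j)
    {Q : ℕ → ℝ} (hQ : ∀ j, 0 ≤ Q j) (hQsum : Summable Q) :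
    ∃ c C B : ℝ, 0 < c ∧ 0 < C ∧ 0 < B ∧ ∀ N : ℕ,
      (Measure.pi fun _ : Fin N => ν)
        {U | ¬ ((∀ j < N, (N : ℝ) / 2 ≤ ∑ n, (⟪φ j, U n⟫ / √(σ j)) ^ 2) ∧
          ∀ k, ∑ j ∈ Finset.range k, Q j * ∑ n, (⟪φ j, U n⟫ / √(σ j)) ^ 2 ≤ B * N)}
        ≤ ENNReal.ofReal (C * Real.exp (-c * N)) := by
  have := hν.prob
  obtain ⟨K, hK, hz⟩ := hν.exists_subgaussianNorm_le
  set z : ℕ → H → ℝ := fun j u => ⟪φ j, u⟫ / √(σ j) with hzdef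
  have hzm : ∀ j, Measurable (z j) := fun j => (measurable_coeff φ j).div_const _
  have hz2 : ∀ j, ∫ u, z j u ^ 2 ∂ν = 1 := fun j => by
    simp only [hzdef, div_pow, Real.sq_sqrt (hσ j).le]
    rw [integral_div, hν.integral_coeff_sq, div_self (hσ j).ne']
  set M : ℝ := (2 * K ^ 2 * 2) ^ 2 with hM
  have hMpos : 0 < M := by positivity
  have hz4 : ∀ j, ∫⁻ u, ENNReal.ofReal (z j u ^ 4) ∂ν ≤ ENNReal.ofReal M := fun j => by
    simpa using lintegral_pow_le_of_subgaussianNorm_le hK.le (hz j) (k := 2) (by norm_num)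
  set a : ℝ := 1 / (8 * M) with ha
  have hapos : 0 < a := by positivity
  -- Chosen so that `b * (2 * K ^ 2) * exp 1 = 1 / 2`.
  set b : ℝ := 1 / (4 * K ^ 2 * Real.exp 1) with hb
  have hbpos : 0 < b := by positivity
  have hexp : ∀ j, ∫⁻ u, ENNReal.ofReal (Real.exp (b * z j u ^ 2)) ∂ν ≤ 2 := fun j =>
    lintegral_exp_sq_le_two (hzm j) hK.le (hz j) hbpos.le (by
      rw [hb]
      refine le_of_eq ?_
      field_simp
      norm_num)
  -- The added `1` keeps `A` positive even if `Q` vanishes.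
  set A : ℝ := ∑' j, Q j + 1 with hA
  have hApos : 0 < A := by have h0 : 0 ≤ ∑' j, Q j := tsum_nonneg hQ; linarith
  have hQA : ∀ k, ∑ j ∈ Finset.range k, Q j ≤ A := fun k => by
    have := hQsum.sum_le_tsum (Finset.range k) fun j _ => hQ j
    linarith
  refine ⟨min (a / 2) 1, 2 / a + 1, 3 * A / b, by positivity, by positivity, by positivity,
    fun N => ?_⟩
  have hsub : {U : Fin N → H | ¬ ((∀ j < N, (N : ℝ) / 2 ≤ ∑ n, z j (U n) ^ 2) ∧
        ∀ k, ∑ j ∈ Finset.range k, Q j * ∑ n, z j (U n) ^ 2 ≤ 3 * A / b * N)}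
      ⊆ (⋃ j ∈ Finset.range N, {U | ∑ n, z j (U n) ^ 2 ≤ N / 2}) ∪
        {U | ∃ k, 3 * A / b * N ≤ ∑ j ∈ Finset.range k, Q j * ∑ n, z j (U n) ^ 2} := by
    intro U hU
    by_contra h
    simp only [Set.mem_union, Set.mem_iUnion, Set.mem_ofPred_eq, Finset.mem_range, not_or,
      not_exists, not_le] at h hU
    exact hU ⟨fun j hj => (h.1 j hj).le, fun k => (h.2 k).le⟩
  refine (measure_mono hsub).trans ((measure_union_le _ _).trans ?_)
  have h1 : (Measure.pi fun _ : Fin N => ν)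
      (⋃ j ∈ Finset.range N, {U : Fin N → H | ∑ n, z j (U n) ^ 2 ≤ N / 2})
      ≤ ENNReal.ofReal (N * Real.exp (-a * N)) := by
    refine (measure_biUnion_finset_le _ _).trans ((Finset.sum_le_sum fun j _ =>
      measure_pi_sum_sq_le_half (hzm j) (hz2 j) hMpos (hz4 j) N).trans_eq ?_)
    rw [Finset.sum_const, Finset.card_range, nsmul_eq_mul,
      ENNReal.ofReal_mul (Nat.cast_nonneg N), ENNReal.ofReal_natCast]
  have h2 := measure_pi_weighted_sum_sq_ge hzm hbpos hexp hQ hApos hQA N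
  refine (add_le_add h1 h2).trans ?_
  rw [← ENNReal.ofReal_add (by positivity) (by positivity)]
  refine ENNReal.ofReal_le_ofReal ?_
  have h3 := natCast_mul_exp_neg_le hapos N
  have hN0 : (0 : ℝ) ≤ N := Nat.cast_nonneg N
  have h4 : Real.exp (-(a / 2) * N) ≤ Real.exp (-(min (a / 2) 1) * N) := by
    gcongr
    exact min_le_left _ _
  have h5 : Real.exp (-(N : ℝ)) ≤ Real.exp (-(min (a / 2) 1) * N) := by
    rw [Real.exp_le_exp]
    nlinarith [min_le_right (a / 2) (1 : ℝ)]
  calc _ ≤ 2 / a * Real.exp (-(min (a / 2) 1) * N) + Real.exp (-(min (a / 2) 1) * N) :=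
        add_le_add (h3.trans (by gcongr)) h5
    _ = _ := by ring

end TrainingLaw

/-! ### The plug-in estimator -/

section PlugIn

variable {H : Type*} [NormedAddCommGroup H] [InnerProductSpace ℝ H]

/-- The plug-in estimator is almost surely well defined when its expected squared coefficients are
summable. -/
theorem ae_summable_ptoTerm_posteriorMeanOp {σ' : ℕ → ℝ} {ν' : Measure (ℕ → ℝ)}
    (hν' : IsTestLaw σ' ν') (q : H →ₗ.[ℝ] ℝ) (φ : HilbertBasis ℕ ℝ H)
    (hq : ∀ j, φ j ∈ q.domain) {μ : ℕ → ℝ≥0} (hμ : ∀ j, 0 < μ j) {l : ℕ → ℝ}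
    (hl : Summable fun j => evalExt q (φ j) ^ 2 * σ' j * l j ^ 2)
    {Ω : Type*} [MeasurableSpace Ω] {P : Measure Ω} [IsProbabilityMeasure P]
    {η : ℕ → H → Ω → ℝ} (hη : ∀ n, IsWhiteNoise (η n) P)
    (hind : iIndepFun (fun n ω (h : H) => η n h ω) P) {N : ℕ} {U : Fin N → H}
    (hU : ∀ n, U n ∈ (diagOp φ l).domain)
    (hs : ∀ n, Summable fun j => evalExt q (φ j) ^ 2 * σ' j * (μ j : ℝ) ^ 2 * ⟪φ j, U n⟫ ^ 2) :
    ∀ᵐ ω ∂P, Summable (ptoTerm q (posteriorMeanOp φ μ U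
      (fullFieldData (diagOp φ l) U fun n h => η n h ω)) φ hν'.memLp) := by
  have hw : ∀ j, 0 ≤ evalExt q (φ j) ^ 2 * σ' j := fun j =>
    mul_nonneg (sq_nonneg _) (hν'.variance_nonneg j)
  obtain ⟨hm, hE⟩ := lintegral_tsum_error hη hind φ hμ l hU hw
  have hrisk : Summable fun j =>
      evalExt q (φ j) ^ 2 * σ' j * eigenvalueRisk (l j) (μ j) (∑ n, ⟪φ j, U n⟫ ^ 2) := by
    refine Summable.of_nonneg_of_le (fun j => mul_nonneg (hw j) ?_) (fun j => ?_)
      (hl.add (summable_sum fun n (_ : n ∈ Finset.univ) => hs n))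
    · rw [eigenvalueRisk]
      positivity
    · refine (mul_le_mul_of_nonneg_left (eigenvalueRisk_le (μ j).coe_nonneg
        (Finset.sum_nonneg fun _ _ => sq_nonneg _)) (hw j)).trans_eq ?_
      rw [mul_add, ← Finset.mul_sum, mul_assoc _ ((μ j : ℝ) ^ 2)]
  have hfin := hrisk.tsum_ofReal_ne_top
  rw [← hE] at hfin
  filter_upwards [ae_lt_top' (AEMeasurable.tsum hm) hfin] with ω hω
  exact hν'.summable_ptoTerm_of_sub q φ hq ((hν'.summable_ptoTerm_iff q φ hq l).2 hl)
    (hν'.summable_error_of_ne_top hω.ne)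

theorem condTestError_le {σ' : ℕ → ℝ} {ν' : Measure (ℕ → ℝ)}
    (hν' : IsTestLaw σ' ν') (q : H →ₗ.[ℝ] ℝ) (φ : HilbertBasis ℕ ℝ H)
    (hq : ∀ j, φ j ∈ q.domain) {μ : ℕ → ℝ≥0} (hμ : ∀ j, 0 < μ j) {l : ℕ → ℝ}
    (hl : Summable (ptoTerm q (diagOp φ l) φ hν'.memLp))
    {Ω : Type*} [MeasurableSpace Ω] {P : Measure Ω} [IsProbabilityMeasure P]
    {η : ℕ → H → Ω → ℝ} (hη : ∀ n, IsWhiteNoise (η n) P)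
    (hind : iIndepFun (fun n ω (h : H) => η n h ω) P) {N : ℕ} {U : Fin N → H}
    (hU : ∀ n, U n ∈ (diagOp φ l).domain) :
    condTestError P (fun n : Fin N => η n) q (diagOp φ l) φ μ hν'.memLp U
      ≤ ∑' j, ENNReal.ofReal (evalExt q (φ j) ^ 2 * σ' j *
        eigenvalueRisk (l j) (μ j) (∑ n, ⟪φ j, U n⟫ ^ 2)) := by
  have hw : ∀ j, 0 ≤ evalExt q (φ j) ^ 2 * σ' j := fun j =>
    mul_nonneg (sq_nonneg _) (hν'.variance_nonneg j)
  rw [← (lintegral_tsum_error hη hind φ hμ l hU hw).2]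
  exact lintegral_mono fun ω => hν'.lintegral_pto_sub_le q φ hq hl _

end PlugIn

end FullField

/-! ### Well-posedness and the convergence rate -/

theorem mainTheorem7
    {H : Type*} [NormedAddCommGroup H] [InnerProductSpace ℝ H] [CompleteSpace H]
    [MeasurableSpace H] [BorelSpace H]
    (φ : HilbertBasis ℕ ℝ H)
    -- the training law, the test law, and their covariance eigenvalues
    (σ σ' : ℕ → ℝ) (ν : Measure H) (ν' : Measure (ℕ → ℝ))
    (hν : FullField.IsTrainingLaw φ σ ν) (hν' : FullField.IsTestLaw σ' ν')
    (α α' : ℝ) (hα : 1 / 2 < α) (hα' : 0 ≤ α')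
    (hσ : FullField.AsympEquiv σ (FullField.powSeq (-2 * α)))
    (hσ' : FullField.AsympLE σ' (FullField.powSeq (-2 * α')))
    -- the eigenvalues of the true forward map
    (l : ℕ → ℝ) (β : ℝ) (hl : FullField.MemSobolevSeq β l)
    -- the prior variances
    (μ : ℕ → ℝ≥0) (hμ_pos : ∀ j, 0 < μ j)
    (hμ : FullField.AsympEquiv (fun j => (μ j : ℝ)) (FullField.powSeq (-2 * β - 1)))
    -- the quantity of interest
    (q : H →ₗ.[ℝ] ℝ) (hq_dom : ∀ j, φ j ∈ q.domain)
    (r : ℝ) (hq : FullField.MemSobolevSeq r fun j => FullField.evalExt q (φ j))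
    (hpto : Summable fun j => |FullField.evalExt q (φ j)| ^ 2 * |l j| ^ 2)
    (hmin : 0 < min α (α' + r) + β)
    -- the noise
    {Ω : Type*} [MeasurableSpace Ω] (P : Measure Ω) [IsProbabilityMeasure P]
    (η : ℕ → H → Ω → ℝ) (hη : ∀ n, FullField.IsWhiteNoise (η n) P)
    (hη_indep : iIndepFun (fun n ω (h : H) => η n h ω) P) :
    -- the observations, the true functional and the plug-in estimator are well defined
    (∀ᵐ u ∂ν, u ∈ (FullField.diagOp φ l).domain) ∧
    Summable (FullField.ptoTerm q (FullField.diagOp φ l) φ hν'.memLp) ∧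
    (∀ N : ℕ, ∀ᵐ U ∂(Measure.pi fun _ : Fin N => ν), ∀ᵐ ω ∂P,
      Summable (FullField.ptoTerm q
        (FullField.posteriorMeanOp φ μ U
          (FullField.fullFieldData (FullField.diagOp φ l) U fun n h => η n h ω)) φ hν'.memLp)) ∧
    -- the error bound
    ∃ c C K : ℝ, 0 < c ∧ 0 < C ∧ 0 < K ∧ ∀ᶠ N : ℕ in atTop,
      (Measure.pi fun _ : Fin N => ν)
        {U | ¬ FullField.condTestError P (fun n : Fin N => η n) q (FullField.diagOp φ l) φ μ
              hν'.memLp U ≤ ENNReal.ofReal (K * FullField.rate α α' β r N)}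
        ≤ ENNReal.ofReal (C * Real.exp (-c * N)) := by
  have hαβ : 0 < α + β := lt_of_lt_of_le hmin (by gcongr; exact min_le_left _ _)
  have hθ : 0 < α' + r + β := lt_of_lt_of_le hmin (by gcongr; exact min_le_right _ _)
  have := hν.prob
  have hσpos := hν.variance_pos hσ
  set b : ℕ → ℝ := fun j => FullField.evalExt q (φ j) with hb
  obtain ⟨C₁, hC₁, hσC⟩ := hσ.exists_bounds hσpos
  obtain ⟨C₂, hC₂, hσ'C⟩ := hσ'.exists_bound
  obtain ⟨C₃, hC₃, hμC⟩ := hμ.exists_bounds fun j => NNReal.coe_pos.2 (hμ_pos j)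
  simp only [FullField.MemSobolevSeq, sq_abs] at hl hq hpto
  have hlnn : ∀ j, 0 ≤ FullField.powSeq (2 * β) j * l j ^ 2 := fun j =>
    mul_nonneg (FullField.powSeq_pos _ _).le (sq_nonneg _)
  have hC₄ : 0 ≤ ∑' j, FullField.powSeq (2 * β) j * l j ^ 2 := tsum_nonneg hlnn
  have hlC : ∀ j, l j ^ 2 ≤ (∑' j, FullField.powSeq (2 * β) j * l j ^ 2)
      * FullField.powSeq (-2 * β) j := by
    intro j
    rw [neg_mul, FullField.powSeq_neg, ← div_eq_mul_inv, le_div_iff₀ (FullField.powSeq_pos _ _),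
      mul_comm]
    exact hl.le_tsum j fun i _ => hlnn i
  obtain ⟨c, hc1, hcC₁, hcC₂, hcC₃, hcC₄⟩ : ∃ c : ℝ, 1 ≤ c ∧ C₁ ≤ c ∧ C₂ ≤ c ∧ C₃ ≤ c ∧
      ∑' j, FullField.powSeq (2 * β) j * l j ^ 2 ≤ c :=
    ⟨1 + C₁ + C₂ + C₃ + ∑' j, FullField.powSeq (2 * β) j * l j ^ 2, by linarith, by linarith,
      by linarith, by linarith, by linarith⟩
  have hc0 : 0 < c := by linarith
  have hweak : ∀ {C : ℝ}, C ≤ c → ∀ {x : ℝ}, 0 ≤ x → C * x ≤ c * x := fun h _ hx =>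
    mul_le_mul_of_nonneg_right h hx
  have hp0 : ∀ p j, 0 ≤ FullField.powSeq p j := fun p j => (FullField.powSeq_pos p j).le
  have hσ₁ : ∀ j, σ j ≤ c * FullField.powSeq (-2 * α) j := fun j =>
    (hσC j).1.trans (hweak hcC₁ (hp0 _ _))
  have hσ'₁ : ∀ j, σ' j ≤ c * FullField.powSeq (-2 * α') j := fun j =>
    (hσ'C j).trans (hweak hcC₂ (hp0 _ _))
  have hμ₁ : ∀ j, (μ j : ℝ) ≤ c * FullField.powSeq (-2 * β - 1) j := fun j =>
    (hμC j).1.trans (hweak hcC₃ (hp0 _ _))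
  have hdomsum : Summable fun j => l j ^ 2 * σ j := by
    refine Summable.of_nonneg_of_le (fun j => mul_nonneg (sq_nonneg _) (hσpos j).le) (fun j => ?_)
      (hl.mul_left c)
    calc l j ^ 2 * σ j ≤ l j ^ 2 * (c * FullField.powSeq (2 * β) j) := by
          gcongr
          exact (hσ₁ j).trans (mul_le_mul_of_nonneg_left
            (FullField.powSeq_le_powSeq (by linarith) j) hc0.le)
      _ = _ := by ring
  have hdom := hν.ae_mem_domain hσpos hdomsum
  have hlsum : Summable fun j => b j ^ 2 * σ' j * l j ^ 2 := by
    refine Summable.of_nonneg_of_le (fun j => mul_nonneg (mul_nonneg (sq_nonneg _)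
      (hν'.variance_nonneg j)) (sq_nonneg _)) (fun j => ?_) (hpto.mul_left c)
    have h1 : FullField.powSeq (-2 * α') j ≤ 1 := by
      rw [← FullField.powSeq_zero j]
      exact FullField.powSeq_le_powSeq (by linarith) j
    calc b j ^ 2 * σ' j * l j ^ 2 ≤ b j ^ 2 * (c * 1) * l j ^ 2 := by
          gcongr
          exact (hσ'₁ j).trans (by gcongr)
      _ = _ := by ring
  have hL : Summable (FullField.ptoTerm q (FullField.diagOp φ l) φ hν'.memLp) :=
    (hν'.summable_ptoTerm_iff q φ hq_dom l).2 hlsum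
  -- This dominates the variance part of the estimator's error for fixed `N`; the exponents compare
  -- by adding `α' + r + β > 0` and `α + β > 0`.
  have hvar : Summable fun j => b j ^ 2 * σ' j * (μ j : ℝ) ^ 2 * σ j := by
    refine Summable.of_nonneg_of_le (fun j => mul_nonneg (mul_nonneg (mul_nonneg (sq_nonneg _)
      (hν'.variance_nonneg j)) (sq_nonneg _)) (hσpos j).le) (fun j => ?_) (hq.mul_left (c ^ 4))
    have hpow : FullField.powSeq (-2 * α') j * FullField.powSeq (-2 * β - 1) j ^ 2
        * FullField.powSeq (-2 * α) j ≤ FullField.powSeq (2 * r) j := by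
      rw [sq, FullField.powSeq_mul, FullField.powSeq_mul, FullField.powSeq_mul]
      exact FullField.powSeq_le_powSeq (by linarith) j
    have := hp0 (-2 * α') j
    have := hp0 (-2 * α) j
    have := hp0 (-2 * β - 1) j
    have := (hσpos j).le
    calc b j ^ 2 * σ' j * (μ j : ℝ) ^ 2 * σ j
        ≤ b j ^ 2 * (c * FullField.powSeq (-2 * α') j)
          * (c * FullField.powSeq (-2 * β - 1) j) ^ 2 * (c * FullField.powSeq (-2 * α) j) := by
          gcongr
          · exact hσ'₁ j
          · exact hμ₁ j
          · exact hσ₁ j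
      _ = c ^ 4 * b j ^ 2 * (FullField.powSeq (-2 * α') j * FullField.powSeq (-2 * β - 1) j ^ 2
        * FullField.powSeq (-2 * α) j) := by ring
      _ ≤ c ^ 4 * b j ^ 2 * FullField.powSeq (2 * r) j := by gcongr
      _ = _ := by ring
  refine ⟨hdom, hL, fun N => ?_, ?_⟩
  · have h1 := hν.ae_summable_coeff_sq hσpos (fun j => mul_nonneg (mul_nonneg (sq_nonneg (b j))
      (hν'.variance_nonneg j)) (sq_nonneg (μ j : ℝ))) hvar
    filter_upwards [FullField.ae_pi_forall hdom N, FullField.ae_pi_forall h1 N] with U hU hUs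
    exact FullField.ae_summable_ptoTerm_posteriorMeanOp hν' q φ hq_dom hμ_pos hlsum hη hη_indep
      hU hUs
  · have hQ0 : ∀ j, 0 ≤ FullField.powSeq (2 * r) j * b j ^ 2 := fun j =>
      mul_nonneg (hp0 _ _) (sq_nonneg _)
    obtain ⟨c', C', B, hc', hC', hB, hconc⟩ := hν.exists_concentration hσpos hQ0 hq
    set A : ℝ := ∑' j, FullField.powSeq (2 * r) j * b j ^ 2 with hA
    have hA0 : 0 ≤ A := tsum_nonneg hQ0
    refine ⟨c', C', 6 * c ^ 6 * (A + B), hc', hC', by positivity, ?_⟩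
    filter_upwards [eventually_ge_atTop 3] with N hN
    -- Up to the null set of samples outside the domain, failure of the bound implies failure of the
    -- concentration event.
    refine le_trans (measure_mono_ae ?_) (hconc N)
    filter_upwards [FullField.ae_pi_forall hdom N] with U hU hbad hgood
    refine hbad ((FullField.condTestError_le hν' q φ hq_dom hμ_pos hL hη hη_indep hU).trans ?_)
    have hN0 : (0 : ℝ) < N := by exact_mod_cast (by omega : 0 < N)
    have hrate := FullField.max_rate_le (α := α) (α' := α') (β := β) (r := r) (by linarith) hN
    have hR : ∀ j, 0 ≤ ∑ n, (⟪φ j, U n⟫ / √(σ j)) ^ 2 := fun j =>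
      Finset.sum_nonneg fun _ _ => sq_nonneg _
    have hterm : ∀ j, b j ^ 2 * σ' j *
        FullField.eigenvalueRisk (l j) (μ j) (∑ n, ⟪φ j, U n⟫ ^ 2)
        ≤ 6 * c ^ 6 * FullField.rate α α' β r N * (FullField.powSeq (2 * r) j * b j ^ 2
          * (1 + (∑ n, (⟪φ j, U n⟫ / √(σ j)) ^ 2) / N)) := by
      intro j
      rw [FullField.sum_coeff_sq_eq φ (hσpos j)]
      refine (FullField.weighted_risk_le hαβ hθ hc1 (by omega) (hσpos j)
        (NNReal.coe_pos.2 (hμ_pos j)) (hσ₁ j) ((hσC j).2.trans (hweak hcC₁ (hσpos j).le))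
        (hσ'₁ j) (hμ₁ j) ((hμC j).2.trans (hweak hcC₃ (μ j).2))
        ((hlC j).trans (hweak hcC₄ (hp0 _ _))) (hR j) (hgood.1 j)).trans ?_
      have := hR j
      have := hQ0 j
      gcongr
    -- Partial sums suffice, and concentration was stated uniformly over them.
    refine ENNReal.tsum_le_of_sum_range_le fun k => ?_
    have hnn : ∀ j, 0 ≤ b j ^ 2 * σ' j *
        FullField.eigenvalueRisk (l j) (μ j) (∑ n, ⟪φ j, U n⟫ ^ 2) := fun j => by
      have := hν'.variance_nonneg j
      rw [FullField.eigenvalueRisk]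
      positivity
    rw [← ENNReal.ofReal_sum_of_nonneg fun j _ => hnn j]
    refine ENNReal.ofReal_le_ofReal ((Finset.sum_le_sum fun j _ => hterm j).trans ?_)
    rw [← Finset.mul_sum]
    have hrate0 : 0 ≤ FullField.rate α α' β r N := (le_max_of_le_left (by positivity)).trans hrate
    have hsum : ∑ j ∈ Finset.range k, FullField.powSeq (2 * r) j * b j ^ 2
        * (1 + (∑ n, (⟪φ j, U n⟫ / √(σ j)) ^ 2) / N) ≤ A + B := by
      simp only [mul_add, mul_one, Finset.sum_add_distrib, ← mul_div_assoc, ← Finset.sum_div]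
      refine add_le_add (hq.sum_le_tsum _ fun j _ => hQ0 j) ?_
      rw [div_le_iff₀ hN0]
      exact hgood.2 k
    calc _ ≤ 6 * c ^ 6 * FullField.rate α α' β r N * (A + B) := by gcongr
      _ = _ := by ring
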